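/- **Setting.** Let $n,d\ge 1$, let $Z_1,\dots,Z_n\in\mathbb{R}^{d\times d}$ be (deterministic) symmetric matrices, and let $\beta^\star\in\mathbb{R}^d$ have support $\Gamma=\{j:\beta^\star_j\neq 0\}$ of size $s\geq 1$. We observe $$y_i=\beta^{\star\top}Z_i\beta^\star+\varepsilon_i,\qquad i=1,\dots,n.$$ Write $|A|_\infty$ for the largest absolute value of an entry of a matrix $A$ (zero for a matrix without entries), $A^{\Gamma_1,\Gamma_2}$ for the submatrix with rows in $\Gamma_1$ and columns in $\Gamma_2$, $\otimes$ for the Kronecker product, and $\|\cdot\|$ for the Euclidean norm. The design is standardised by $\sum_{i=1}^n|Z_i|_\infty^2=n$, and there are constants $0<c_1\le c_2$ with $c_1\le|\beta^\star_j|\le c_2$ for all $j\in\Gamma$. **Assumption 1 (penalty).** $\lambda_n,\varrho,\mu>0$, and $P_{\lambda_n}(\beta)=\sum_{j=1}^d p(|\beta_j|)$, where the scalar function $p$ satisfies: $p$ is concave on $(0,\infty)$ and $t\mapsto p(t)+\frac{\mu}{2}t^2$ is convex on $[0,\infty)$; $p(0)=0$ and $p(t)>0$ for $t>0$; on $(0,\infty)$,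 $p$ is non-decreasing and $t\mapsto p(t)/t$ is non-increasing; $p$ is differentiable on $(0,\infty)$, $p'$ is locally Lipschitz there, and $\lim_{t\to0^+}p'(t)=\lambda_n\varrho$. **Assumption 2 (noise).** $\varepsilon_1,\dots,\varepsilon_n$ are independent and identically distributed with mean zero and positive variance, and are sub-Gaussian with variance proxy $\sigma^2$, $\sigma>0$, i.e. $\mathbb{E}e^{t\varepsilon_i}\le e^{\sigma^2t^2/2}$ for all $t\in\mathbb{R}$. **Assumption 3.** There are constants $c_4\ge c_3>0$ such that for all $x,y\in\mathbb{R}^{\Gamma}$, $$c_3\|x\|^2\|y\|^2\le\frac1n\sum_{i=1}^n\bigl(x^\top Z_i^{\Gamma,\Gamma}y\bigr)^2\le c_4\|x\|^2\|y\|^2 .$$ **Assumption 4.** There is a constant $c_5>0$ such that $$\Bigl|\sum_{i=1}^nZ_i^{\Gamma,\Gamma}\otimes Z_i^{\Gamma^c,\Gamma^c}\Bigr|_\infty\le c_5\sqrt n,\qquad \Bigl|\sum_{i=1}^nZ_i^{\Gamma,\Gamma}\otimes Z_i^{\Gamma^c,\Gamma}\Bigr|_\infty\le c_5\sqrt n .$$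 Put $$C_0=\max\Bigl\{\frac{10\sigma\sqrt{c_4}}{c_1c_3},\frac{4}{c_1^2c_3}\Bigr\},\quad r_n=C_0\Bigl(\sqrt{\tfrac{\ln(1+2n)}{n}}+\frac{\lambda_n\varrho}{\sqrt s}\Bigr),\quad p_1=2e^{-s\ln(1+2n)},\quad p_2=n^{-n/2}.$$ **Theorem.** Under Assumptions 1–4, suppose that $$36c_2^2c_5C_0s^2\le\sqrt n,\qquad \sqrt{\tfrac{2\ln(1+2n)}{n}}\le c_2C_0^{-1},\qquad \tfrac{3}{\sqrt{ns}}\le c_2,$$ $$\max\Bigl\{\sqrt{\tfrac{s\ln(1+2n)}{n}},\ 6\sqrt2\,c_2\sigma s\sqrt{\tfrac{s\ln(1+2n)+\ln d}{n}}\Bigr\}\le\lambda_n\varrho\le\frac{c_2\sqrt s}{\sqrt2\,C_0},$$ $$\mu\le c_1^2c_3s,\qquad 2(4c_3+3c_4)c_2r_n+10\sigma\sqrt{c_4}\sqrt{\tfrac{\ln(1+2n)}{n}}\le c_1^2c_3\sqrt s .$$ Then there is a random vector $\hat\beta$ (a measurable function on the underlying probability space) which is always a local minimiser over $\beta\in\mathbb{R}^d$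 of $$\frac1{4n}\sum_{i=1}^n\bigl(\beta^\top Z_i\beta-y_i\bigr)^2+P_{\lambda_n}(\beta)$$ and which satisfies (i) $\mathbb{P}\bigl(\hat\beta_{\Gamma^c}=0\bigr)\ge1-p_1-2p_2-\frac2n$; (ii) $\mathbb{P}\bigl(\min\{\|\hat\beta+\beta^\star\|,\|\hat\beta-\beta^\star\|\}\le r_n\bigr)\ge1-p_1-2p_2-\frac2n$. -/

import Mathlib

open MeasureTheory ProbabilityTheory Filter Topology
open scoped Matrix Kronecker

noncomputable section

namespace QuadReg

/-- The bilinear form `xᵀ A y` of a square matrix on Euclidean space. -/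
def bil {ι : Type*} [Fintype ι] (A : Matrix ι ι ℝ) (x y : EuclideanSpace ℝ ι) : ℝ :=
  x.ofLp ⬝ᵥ (A *ᵥ y.ofLp)

/-- The largest absolute value of an entry of a matrix (`0` for a matrix without entries). -/
def entrySup {m k : Type*} (A : Matrix m k ℝ) : ℝ :=
  ⨆ q : m × k, |A q.1 q.2|

/-- The support of a vector. -/
def supp {d : ℕ} (β : EuclideanSpace ℝ (Fin d)) : Finset (Fin d) :=
  Finset.univ.filter fun j => β j ≠ 0

/-- The submatrix with rows indexed by `Γ₁` and columns indexed by `Γ₂`. -/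
def sub {d : ℕ} (A : Matrix (Fin d) (Fin d) ℝ) (Γ₁ Γ₂ : Finset (Fin d)) : Matrix Γ₁ Γ₂ ℝ :=
  A.submatrix (fun j => (j : Fin d)) (fun j => (j : Fin d))

/-- The responses `y i = βᵀ (Z i) β + e i` of the quadratic measurement model. -/
def response {n d : ℕ} (Z : Fin n → Matrix (Fin d) (Fin d) ℝ)
    (β : EuclideanSpace ℝ (Fin d)) (e : Fin n → ℝ) : Fin n → ℝ :=
  fun i => bil (Z i) β β + e i

/-- The penalised least squares objective
`(1 / (4 n)) ∑ i, (βᵀ (Z i) β - y i)² + ∑ j, p |β j|`. -/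
def objective {n d : ℕ} (Z : Fin n → Matrix (Fin d) (Fin d) ℝ) (y : Fin n → ℝ) (p : ℝ → ℝ)
    (β : EuclideanSpace ℝ (Fin d)) : ℝ :=
  1 / (4 * (n : ℝ)) * ∑ i, (bil (Z i) β β - y i) ^ 2 + ∑ j, p |β j|

/-- Weakly-convex-concave scalar penalties. Only the values of `p` on `[0, ∞)` matter.
(Subdifferentiability at `0` is automatic: by `zero` and `pos` the function `t ↦ p |t|` has its
minimum at `0`, so `0` is a subgradient there.) -/
structure IsWCCP (p : ℝ → ℝ) (lam rho mu : ℝ) : Prop where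
  lam_pos : 0 < lam
  rho_pos : 0 < rho
  mu_pos : 0 < mu
  concave : ConcaveOn ℝ (Set.Ioi 0) p
  weakly_convex : ConvexOn ℝ (Set.Ici 0) (fun t => p t + mu / 2 * t ^ 2)
  zero : p 0 = 0
  pos : ∀ t, 0 < t → 0 < p t
  mono : MonotoneOn p (Set.Ioi 0)
  ratio_anti : AntitoneOn (fun t => p t / t) (Set.Ioi 0)
  diff : ∀ t, 0 < t → DifferentiableAt ℝ p t
  deriv_zero : Tendsto (deriv p) (𝓝[>] 0) (𝓝 (lam * rho))
  deriv_lip : LocallyLipschitzOn (Set.Ioi 0) (deriv p)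

/-- Independent, identically distributed, centred sub-Gaussian errors with variance proxy `σ ^ 2`
and positive variance. -/
structure IsNoise {Ω : Type*} [MeasurableSpace Ω] (P : Measure Ω) {n : ℕ} (ε : Fin n → Ω → ℝ)
    (σ : ℝ) : Prop where
  sigma_pos : 0 < σ
  meas : ∀ i, Measurable (ε i)
  indep : iIndepFun ε P
  ident : ∀ i j, IdentDistrib (ε i) (ε j) P P
  subgaussian : ∀ i, HasSubgaussianMGF (ε i) (Real.toNNReal (σ ^ 2)) P
  mean_zero : ∀ i, ∫ ω, ε i ω ∂P = 0
  var_pos : ∀ i, 0 < ∫ ω, ε i ω ^ 2 ∂P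

/-- Two-sided bound on the bilinear measurements restricted to the index set `Γ`. -/
def RestrictedBounds {n d : ℕ} (Z : Fin n → Matrix (Fin d) (Fin d) ℝ) (Γ : Finset (Fin d))
    (c₃ c₄ : ℝ) : Prop :=
  ∀ x y : EuclideanSpace ℝ Γ,
    c₃ * ‖x‖ ^ 2 * ‖y‖ ^ 2 ≤ 1 / (n : ℝ) * ∑ i, bil (sub (Z i) Γ Γ) x y ^ 2 ∧
    1 / (n : ℝ) * ∑ i, bil (sub (Z i) Γ Γ) x y ^ 2 ≤ c₄ * ‖x‖ ^ 2 * ‖y‖ ^ 2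

/-- Partial orthogonality of the design between `Γ` and its complement. -/
def PartialOrthogonality {n d : ℕ} (Z : Fin n → Matrix (Fin d) (Fin d) ℝ) (Γ : Finset (Fin d))
    (c₅ : ℝ) : Prop :=
  entrySup (∑ i, sub (Z i) Γ Γ ⊗ₖ sub (Z i) Γᶜ Γᶜ) ≤ c₅ * √(n : ℝ) ∧
  entrySup (∑ i, sub (Z i) Γ Γ ⊗ₖ sub (Z i) Γᶜ Γ) ≤ c₅ * √(n : ℝ)

/-- The constant `C₀ = max {10 σ √c₄ / (c₁ c₃), 4 / (c₁² c₃)}`. -/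
def C₀ (σ c₁ c₃ c₄ : ℝ) : ℝ :=
  max (10 * σ * √c₄ / (c₁ * c₃)) (4 / (c₁ ^ 2 * c₃))

/-- The error radius `C * (√(ln (1 + 2 n) / n) + lam * rho / √s)`. -/
def radius (n s : ℕ) (C lam rho : ℝ) : ℝ :=
  C * (√(Real.log (1 + 2 * n) / n) + lam * rho / √(s : ℝ))

/-- The failure probability `p₁ = 2 exp (- s ln (1 + 2 n))`. -/
def prob₁ (n s : ℕ) : ℝ := 2 * Real.exp (-(s * Real.log (1 + 2 * n)))

/-- The failure probability `p₂ = n ^ (- n / 2)`. -/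
def prob₂ (n : ℕ) : ℝ := (n : ℝ) ^ (-(n : ℝ) / 2)

end QuadReg

end

/-! The estimator minimises the objective over the ball of radius `r` about `βs`, intersected with
the vectors supported on `Γ = supp βs`. Everything is deterministic once the errors satisfy
`GoodErrors`: the noise form on `Γ` is at most `N` and every averaged noise entry is at most `t`.

On that event three things hold. The lower restricted bound and the Lipschitz penalty
(`basic_inequality`) push the minimiser strictly inside the ball, so it is locally minimal within
the subspace. The lower bound also dominates noise, displacement and weak concavity in
`objective_midpoint`, so the minimiser is unique and hence measurable in the errors
(`exists_measurable_minimizer`). Finally, partial orthogonality and the entrywise noise bound keep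
the loss gradient off `Γ` below `lam * rho`, the slope of the penalty at zero, so leaving the
subspace does not pay (`isLocalMin_of_strict_dual`).

Off the event the estimator is `0`, always a local minimiser since the loss gradient vanishes there.
The event fails with probability at most `prob₁ n s`, by Hoeffding bounds over a net of the unit
ball and over the matrix entries. -/

namespace QuadReg

/-! ### Bilinear forms: polarisation and reduction to a net -/

section Bilinear

variable {ι : Type*} [Fintype ι]

lemma bil_eq_sum (A : Matrix ι ι ℝ) (x y : EuclideanSpace ℝ ι) :
    bil A x y = ∑ j, ∑ k, A j k * x j * y k := by
  simp only [bil, dotProduct, Matrix.mulVec, Finset.mul_sum]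
  exact Finset.sum_congr rfl fun j _ => Finset.sum_congr rfl fun k _ => by ring

lemma bil_add_left (A : Matrix ι ι ℝ) (x y z : EuclideanSpace ℝ ι) :
    bil A (x + y) z = bil A x z + bil A y z := by
  simp [bil, add_dotProduct]

lemma bil_add_right (A : Matrix ι ι ℝ) (x y z : EuclideanSpace ℝ ι) :
    bil A x (y + z) = bil A x y + bil A x z := by
  simp [bil, Matrix.mulVec_add, dotProduct_add]

lemma bil_sub_left (A : Matrix ι ι ℝ) (x y z : EuclideanSpace ℝ ι) :
    bil A (x - y) z = bil A x z - bil A y z := by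
  simp [bil, sub_dotProduct]

lemma bil_sub_right (A : Matrix ι ι ℝ) (x y z : EuclideanSpace ℝ ι) :
    bil A x (y - z) = bil A x y - bil A x z := by
  simp [bil, Matrix.mulVec_sub, dotProduct_sub]

lemma bil_smul_left (A : Matrix ι ι ℝ) (a : ℝ) (x y : EuclideanSpace ℝ ι) :
    bil A (a • x) y = a * bil A x y := by
  simp [bil]

lemma bil_smul_right (A : Matrix ι ι ℝ) (a : ℝ) (x y : EuclideanSpace ℝ ι) :
    bil A x (a • y) = a * bil A x y := by
  simp [bil, Matrix.mulVec_smul]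

lemma bil_comm {A : Matrix ι ι ℝ} (hA : A.IsSymm) (x y : EuclideanSpace ℝ ι) :
    bil A x y = bil A y x := by
  rw [bil, bil, ← Matrix.dotProduct_transpose_mulVec, hA.eq]

lemma bil_sum_smul {κ : Type*} [Fintype κ] (A : κ → Matrix ι ι ℝ) (a : κ → ℝ)
    (x y : EuclideanSpace ℝ ι) :
    bil (∑ i, a i • A i) x y = ∑ i, a i * bil (A i) x y := by
  simp [bil, Matrix.sum_mulVec, dotProduct_sum, Matrix.smul_mulVec]

@[fun_prop]
lemma continuous_bil {X : Type*} [TopologicalSpace X] (A : Matrix ι ι ℝ)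
    {f g : X → EuclideanSpace ℝ ι} (hf : Continuous f) (hg : Continuous g) :
    Continuous fun x => bil A (f x) (g x) := by
  simp only [bil_eq_sum]
  fun_prop

/-- A bound for a symmetric quadratic form polarises to the bilinear form. -/
lemma abs_bil_le_of_abs_quad_le {A : Matrix ι ι ℝ} (hA : A.IsSymm) {N : ℝ}
    (h : ∀ x : EuclideanSpace ℝ ι, |bil A x x| ≤ N * ‖x‖ ^ 2) (x y : EuclideanSpace ℝ ι) :
    |bil A x y| ≤ N * ‖x‖ * ‖y‖ := by
  have key : ∀ u v : EuclideanSpace ℝ ι, ‖u‖ = 1 → ‖v‖ = 1 → |bil A u v| ≤ N := by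
    intro u v hu hv
    have h1 := abs_le.1 (h (u + v))
    have h2 := abs_le.1 (h (u - v))
    have h3 := parallelogram_law_with_norm ℝ u v
    have e1 : bil A (u + v) (u + v) = bil A u u + 2 * bil A u v + bil A v v := by
      rw [bil_add_left, bil_add_right, bil_add_right, bil_comm hA v u]; ring
    have e2 : bil A (u - v) (u - v) = bil A u u - 2 * bil A u v + bil A v v := by
      rw [bil_sub_left, bil_sub_right, bil_sub_right, bil_comm hA v u]; ring
    rw [e1] at h1
    rw [e2] at h2
    have h4 : N * ‖u + v‖ ^ 2 + N * ‖u - v‖ ^ 2 = 4 * N := by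
      rw [hu, hv] at h3
      linear_combination N * h3
    exact abs_le.2 ⟨by linarith, by linarith⟩
  rcases eq_or_ne x 0 with rfl | hx
  · simp [bil]
  rcases eq_or_ne y 0 with rfl | hy
  · simp [bil]
  have hx' : 0 < ‖x‖ := norm_pos_iff.2 hx
  have hy' : 0 < ‖y‖ := norm_pos_iff.2 hy
  have := key (‖x‖⁻¹ • x) (‖y‖⁻¹ • y) (by simp [norm_smul, hx'.ne']) (by simp [norm_smul, hy'.ne'])
  rw [bil_smul_left, bil_smul_right, abs_mul, abs_mul, abs_inv, abs_inv, abs_norm, abs_norm,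
    inv_mul_le_iff₀ hx', inv_mul_le_iff₀ hy'] at this
  linarith

/-- A bound for a symmetric quadratic form on a `1 / 4`-net of the unit ball controls the form. -/
lemma abs_bil_le_of_net {A : Matrix ι ι ℝ} (hA : A.IsSymm) {T : Set (EuclideanSpace ℝ ι)}
    (hT : ∀ x : EuclideanSpace ℝ ι, ‖x‖ ≤ 1 → ∃ y ∈ T, ‖y‖ ≤ 1 ∧ ‖x - y‖ ≤ 1 / 4) {t : ℝ}
    (h : ∀ y ∈ T, |bil A y y| ≤ t) (x y : EuclideanSpace ℝ ι) :
    |bil A x y| ≤ 2 * t * ‖x‖ * ‖y‖ := by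
  obtain ⟨x₀, hx₀, hmax⟩ := (isCompact_closedBall (0 : EuclideanSpace ℝ ι) 1).exists_isMaxOn
    ⟨0, by simp⟩ (f := fun x => |bil A x x|) (by fun_prop)
  set N := |bil A x₀ x₀| with hN
  have hquad : ∀ x : EuclideanSpace ℝ ι, |bil A x x| ≤ N * ‖x‖ ^ 2 := by
    intro x
    rcases eq_or_ne x 0 with rfl | hx
    · simp [bil]
    have hx' : 0 < ‖x‖ := norm_pos_iff.2 hx
    have := hmax (show ‖x‖⁻¹ • x ∈ Metric.closedBall (0 : EuclideanSpace ℝ ι) 1 by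
      simp [norm_smul, hx'.ne'])
    simp only [Set.mem_ofPred_eq, bil_smul_left, bil_smul_right, abs_mul, abs_inv, abs_norm] at this
    rw [inv_mul_le_iff₀ hx', inv_mul_le_iff₀ hx'] at this
    nlinarith
  have hbil := abs_bil_le_of_abs_quad_le hA hquad
  have hx₀' : ‖x₀‖ ≤ 1 := by simpa using hx₀
  obtain ⟨z, hzT, hz1, hz⟩ := hT x₀ hx₀'
  -- The difference of the two quadratic values factors, and the factors have norms at most `1 / 4`
  -- and `2`. So `N ≤ t + N / 2`, and the last term is absorbed.
  have e : bil A x₀ x₀ = bil A z z + bil A (x₀ - z) (x₀ + z) := by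
    rw [bil_sub_left, bil_add_right, bil_add_right, bil_comm hA z x₀]; ring
  have hN0 : 0 ≤ N := abs_nonneg _
  have h1 : N ≤ 2 * t := by
    have h2 : N ≤ |bil A z z| + |bil A (x₀ - z) (x₀ + z)| := by
      rw [hN, e]; exact abs_add_le _ _
    have h3 : ‖x₀ + z‖ ≤ 2 := (norm_add_le _ _).trans (by linarith)
    have h4 : N * ‖x₀ - z‖ * ‖x₀ + z‖ ≤ N * (1 / 4) * 2 := by gcongr
    linarith [h z hzT, hbil (x₀ - z) (x₀ + z)]
  calc |bil A x y| ≤ N * ‖x‖ * ‖y‖ := hbil x y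
    _ ≤ 2 * t * ‖x‖ * ‖y‖ := by gcongr

end Bilinear

/-! ### Volumetric covering of the unit ball -/

section Net

variable {E : Type*} [NormedAddCommGroup E] [NormedSpace ℝ E] [FiniteDimensional ℝ E]

open Metric Module ENNReal in
-- Balls of radius `1 / 8` about the points are disjoint and lie in the ball of radius `9 / 8`; the
-- ratio of radii is `9`.
lemma card_le_of_separated_unitBall (T : Finset E) (hT : ∀ c ∈ T, ‖c‖ ≤ 1)
    (h : ∀ c ∈ T, ∀ d ∈ T, c ≠ d → 1 / 4 ≤ ‖c - d‖) : T.card ≤ 9 ^ finrank ℝ E := by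
  borelize E
  let μ : Measure E := Measure.addHaar
  let δ : ℝ := 1 / 8
  let ρ : ℝ := 9 / 8
  have ρpos : 0 < ρ := by norm_num [ρ]
  have δpos : 0 < δ := by norm_num [δ]
  have D : Set.Pairwise (T : Set E) (Function.onFun Disjoint fun c => ball (c : E) δ) := by
    rintro c hc d hd hcd
    apply ball_disjoint_ball
    rw [dist_eq_norm]
    have := h c hc d hd hcd
    norm_num [δ]
    linarith
  have hsub : (⋃ c ∈ T, ball (c : E) δ) ⊆ ball (0 : E) ρ := by
    refine Set.iUnion₂_subset fun x hx => ball_subset_ball' ?_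
    rw [dist_zero_right]
    have := hT x hx
    norm_num [δ, ρ]
    linarith
  have I : (T.card : ℝ≥0∞) * ENNReal.ofReal (δ ^ finrank ℝ E) * μ (ball 0 1) ≤
      ENNReal.ofReal (ρ ^ finrank ℝ E) * μ (ball 0 1) :=
    calc
      _ = μ (⋃ c ∈ T, ball (c : E) δ) := by
        rw [measure_biUnion_finset D fun c _ => measurableSet_ball]
        simp only [μ.addHaar_ball_of_pos _ δpos]
        simp only [Finset.sum_const, nsmul_eq_mul, mul_assoc]
      _ ≤ μ (ball (0 : E) ρ) := measure_mono hsub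
      _ = _ := by simp only [μ.addHaar_ball_of_pos _ ρpos]
  have J : (T.card : ℝ≥0∞) * ENNReal.ofReal (δ ^ finrank ℝ E) ≤ ENNReal.ofReal (ρ ^ finrank ℝ E) :=
    (ENNReal.mul_le_mul_iff_left (measure_ball_pos _ _ zero_lt_one).ne' measure_ball_lt_top.ne).1 I
  have K := ENNReal.toReal_le_of_le_ofReal (pow_nonneg ρpos.le _) J
  rw [ENNReal.toReal_mul, ENNReal.toReal_natCast, ENNReal.toReal_ofReal (by positivity)] at K
  have e : ρ ^ finrank ℝ E = 9 ^ finrank ℝ E * δ ^ finrank ℝ E := by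
    rw [← mul_pow]; norm_num [ρ, δ]
  rw [e] at K
  exact_mod_cast le_of_mul_le_mul_right K (by positivity)

/-- The unit ball of a `k`-dimensional space has a `1 / 4`-net with at most `9 ^ k` points. -/
lemma exists_net_unitBall (E : Type*) [NormedAddCommGroup E] [NormedSpace ℝ E]
    [FiniteDimensional ℝ E] :
    ∃ T : Finset E, T.card ≤ 9 ^ Module.finrank ℝ E ∧ (∀ y ∈ T, ‖y‖ ≤ 1) ∧
      ∀ x : E, ‖x‖ ≤ 1 → ∃ y ∈ T, ‖x - y‖ ≤ 1 / 4 := by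
  classical
  let Good : Finset E → Prop := fun T => (∀ c ∈ T, ‖c‖ ≤ 1) ∧
    ∀ c ∈ T, ∀ d ∈ T, c ≠ d → 1 / 4 ≤ ‖c - d‖
  let S : Set ℕ := {m | ∃ T, Good T ∧ T.card = m}
  have hbdd : BddAbove S := ⟨9 ^ Module.finrank ℝ E, by
    rintro _ ⟨T, hT, rfl⟩
    exact card_le_of_separated_unitBall T hT.1 hT.2⟩
  have hne : S.Nonempty := ⟨0, ∅, ⟨by simp, by simp⟩, rfl⟩
  obtain ⟨T, hT, hcard⟩ := Nat.sSup_mem hne hbdd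
  refine ⟨T, card_le_of_separated_unitBall T hT.1 hT.2, hT.1, fun x hx => ?_⟩
  -- A separated set of maximal cardinality is a net: an uncovered point could be added to it.
  by_contra! hcon
  have hxT : x ∉ T := fun h => by
    have := hcon x h
    norm_num at this
  have : (insert x T).card ∈ S := by
    refine ⟨insert x T, ⟨?_, ?_⟩, rfl⟩
    · intro c hc
      rcases Finset.mem_insert.1 hc with rfl | hc
      exacts [hx, hT.1 c hc]
    · intro c hc d hd hcd
      rcases Finset.mem_insert.1 hc with hc' | hc' <;> rcases Finset.mem_insert.1 hd with hd' | hd'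
      · exact absurd (hc'.trans hd'.symm) hcd
      · rw [hc']; exact (hcon d hd').le
      · rw [hd', norm_sub_rev]; exact (hcon c hc').le
      · exact hT.2 c hc' d hd' hcd
  have h2 := le_csSup hbdd this
  rw [Finset.card_insert_of_notMem hxT, ← hcard] at h2
  omega

end Net

/-! ### Sub-Gaussian tails of linear statistics -/

section Tail

variable {Ω : Type*} [MeasurableSpace Ω] {P : Measure Ω} {n : ℕ} {ε : Fin n → Ω → ℝ} {σ : ℝ}

/-- Two-sided Hoeffding bound for linear combinations of the errors. -/
lemma IsNoise.measureReal_abs_sum_ge_le [IsProbabilityMeasure P] (hε : IsNoise P ε σ)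
    (a : Fin n → ℝ) {V t : ℝ} (hV : ∑ i, a i ^ 2 ≤ V) (ht : 0 < t) :
    P.real {ω | t < |∑ i, a i * ε i ω|} ≤ 2 * Real.exp (-t ^ 2 / (2 * (σ ^ 2 * V))) := by
  have main : ∀ b : Fin n → ℝ, ∑ i, b i ^ 2 ≤ V →
      P.real {ω | t < ∑ i, b i * ε i ω} ≤ Real.exp (-t ^ 2 / (2 * (σ ^ 2 * V))) := by
    intro b hb
    have hindep : iIndepFun (fun i ω => b i * ε i ω) P :=
      hε.indep.comp (fun i x => b i * x) (fun i => measurable_const_mul (b i))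
    have hsub1 : ∀ i, HasSubgaussianMGF (fun ω => b i * ε i ω) (Real.toNNReal (σ ^ 2 * b i ^ 2)) P := by
      intro i
      have h := (hε.subgaussian i).const_mul (b i)
      convert h using 1
      refine NNReal.eq ?_
      rw [Real.coe_toNNReal _ (by positivity)]
      change _ = b i ^ 2 * (Real.toNNReal (σ ^ 2) : ℝ)
      rw [Real.coe_toNNReal _ (by positivity), mul_comm]
    have hsub := HasSubgaussianMGF.sum_of_iIndepFun hindep (s := Finset.univ) fun i _ => hsub1 i
    have hσ := hε.sigma_pos
    -- With zero variance the exponent reads as division by zero and the general bound is the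
    -- trivial `1`; but then the event is empty because `t > 0`.
    by_cases hb0 : ∑ i, b i ^ 2 = 0
    · have hz : ∀ i, b i = 0 := fun i => by
        have := (Finset.sum_eq_zero_iff_of_nonneg (fun i _ => sq_nonneg (b i))).1 hb0 i
          (Finset.mem_univ i)
        simpa using this
      simp [hz, ht.not_gt, Real.exp_nonneg]
    have hb1 : 0 < ∑ i, b i ^ 2 := lt_of_le_of_ne (Finset.sum_nonneg fun i _ => sq_nonneg _)
      (Ne.symm hb0)
    have hle : {ω | t < ∑ i, b i * ε i ω} ⊆ {ω | t ≤ ∑ i, b i * ε i ω} := by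
      intro ω h
      simp only [Set.mem_ofPred_eq] at h ⊢
      exact h.le
    refine (measureReal_mono hle).trans ((hsub.measure_ge_le ht.le).trans ?_)
    have e : ((∑ i, Real.toNNReal (σ ^ 2 * b i ^ 2) : NNReal) : ℝ) = σ ^ 2 * ∑ i, b i ^ 2 := by
      rw [NNReal.coe_sum, Finset.mul_sum]
      exact Finset.sum_congr rfl fun i _ => Real.coe_toNNReal _ (by positivity)
    rw [e]
    apply Real.exp_le_exp.2
    rw [neg_div, neg_div, neg_le_neg_iff]
    gcongr
  have hsplit : {ω | t < |∑ i, a i * ε i ω|} ⊆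
      {ω | t < ∑ i, a i * ε i ω} ∪ {ω | t < ∑ i, (-a i) * ε i ω} := by
    intro ω hω
    simpa [lt_abs] using hω
  refine (measureReal_mono hsplit).trans ((measureReal_union_le _ _).trans ?_)
  have h2 := main (fun i => -a i) (by simpa using hV)
  linarith [main a hV]

end Tail

/-! ### Analytic properties of the scalar penalty -/

section Penalty

variable {p : ℝ → ℝ} {lam rho mu : ℝ}

namespace IsWCCP

lemma slope_pos (hp : IsWCCP p lam rho mu) : 0 < lam * rho := mul_pos hp.lam_pos hp.rho_pos

lemma nonneg (hp : IsWCCP p lam rho mu) {t : ℝ} (ht : 0 ≤ t) : 0 ≤ p t := by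
  rcases ht.eq_or_lt with rfl | h
  exacts [hp.zero.ge, (hp.pos t h).le]

lemma monotoneOn (hp : IsWCCP p lam rho mu) : MonotoneOn p (Set.Ici 0) := by
  intro a ha b hb hab
  rcases (show (0 : ℝ) ≤ a from ha).eq_or_lt with rfl | h
  · rw [hp.zero]; exact hp.nonneg hb
  · exact hp.mono h (h.trans_le hab) hab

/-- Continuity at the endpoint comes from convexity: the chord of `p t + mu / 2 * t ^ 2` over `[0,
1]` squeezes `p` against zero. -/
lemma tendsto_zero (hp : IsWCCP p lam rho mu) : Tendsto p (𝓝[≥] 0) (𝓝 0) := by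
  have hup : ∀ᶠ t in 𝓝[≥] (0 : ℝ), p t ≤ t * (p 1 + mu / 2) := by
    filter_upwards [Icc_mem_nhdsGE (show (0 : ℝ) < 1 by norm_num)] with t ht
    have := hp.weakly_convex.2 (x := 0) (y := 1) (by simp) (by simp)
      (show 0 ≤ 1 - t by linarith [ht.2]) ht.1 (by ring)
    simp only [smul_eq_mul, mul_zero, mul_one, zero_add, hp.zero] at this
    have hmu := hp.mu_pos
    nlinarith [mul_nonneg hmu.le (sq_nonneg t)]
  have hlo : ∀ᶠ t in 𝓝[≥] (0 : ℝ), 0 ≤ p t := by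
    filter_upwards [self_mem_nhdsWithin] with t ht using hp.nonneg ht
  refine tendsto_of_tendsto_of_tendsto_of_le_of_le' tendsto_const_nhds ?_ hlo hup
  have : Tendsto (fun t : ℝ => t * (p 1 + mu / 2)) (𝓝 0) (𝓝 (0 * (p 1 + mu / 2))) := by
    exact (continuous_id.mul continuous_const).tendsto 0
  rw [zero_mul] at this
  exact this.mono_left nhdsWithin_le_nhds

lemma continuousOn (hp : IsWCCP p lam rho mu) : ContinuousOn p (Set.Ici 0) := by
  intro t ht
  rcases (show (0 : ℝ) ≤ t from ht).eq_or_lt with rfl | h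
  · rw [ContinuousWithinAt, hp.zero]
    exact hp.tendsto_zero
  · exact (hp.diff t h).continuousAt.continuousWithinAt

lemma continuous_comp_abs (hp : IsWCCP p lam rho mu) : Continuous fun t => p |t| :=
  hp.continuousOn.comp_continuous continuous_abs fun t => abs_nonneg t

/-- Concavity makes the derivative antitone, so its limit at `0` is its supremum. -/
lemma deriv_le (hp : IsWCCP p lam rho mu) {t : ℝ} (ht : 0 < t) : deriv p t ≤ lam * rho := by
  have hanti : ∀ u ∈ Set.Ioo 0 t, deriv p t ≤ deriv p u := fun u hu =>
    hp.concave.antitoneOn_deriv (fun x hx => hp.diff x hx) hu.1 ht hu.2.le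
  refine ge_of_tendsto hp.deriv_zero ?_
  filter_upwards [Ioo_mem_nhdsGT ht] with u hu using hanti u hu

lemma sub_le (hp : IsWCCP p lam rho mu) {a b : ℝ} (ha : 0 ≤ a) (hab : a ≤ b) :
    p b - p a ≤ lam * rho * (b - a) := by
  refine (convex_Icc a b).image_sub_le_mul_sub_of_deriv_le
    (hp.continuousOn.mono fun x hx => ha.trans hx.1) ?_ ?_ a ⟨le_rfl, hab⟩ b ⟨hab, le_rfl⟩ hab
  · intro x hx
    rw [interior_Icc] at hx
    exact (hp.diff x (ha.trans_lt hx.1)).differentiableWithinAt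
  · intro x hx
    rw [interior_Icc] at hx
    exact hp.deriv_le (ha.trans_lt hx.1)

/-- The penalty is Lipschitz with constant `lam * rho`. -/
lemma abs_sub_le (hp : IsWCCP p lam rho mu) (a b : ℝ) :
    p |a| - p |b| ≤ lam * rho * |a - b| := by
  have hs := hp.slope_pos
  rcases le_total |b| |a| with h | h
  · refine (hp.sub_le (abs_nonneg b) h).trans ?_
    have := abs_sub_abs_le_abs_sub a b
    gcongr
  · have := hp.monotoneOn (abs_nonneg a) (abs_nonneg b) h
    have : 0 ≤ lam * rho * |a - b| := by positivity
    linarith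

/-- Near the origin the penalty grows at every rate below `lam * rho`. -/
lemma eventually_mul_abs_le (hp : IsWCCP p lam rho mu) {κ : ℝ} (hκ : κ < lam * rho) :
    ∀ᶠ t in 𝓝 (0 : ℝ), κ * |t| ≤ p |t| := by
  obtain ⟨δ, hδ, hδ'⟩ : ∃ δ > 0, Set.Ioo 0 δ ⊆ {t | κ < deriv p t} :=
    mem_nhdsGT_iff_exists_Ioo_subset.1 (hp.deriv_zero.eventually (lt_mem_nhds hκ))
  filter_upwards [Metric.ball_mem_nhds (0 : ℝ) hδ] with t ht
  have ht' : |t| < δ := by simpa using ht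
  have := (convex_Icc 0 |t|).mul_sub_le_image_sub_of_le_deriv (f := p) (C := κ)
    (hp.continuousOn.mono fun x hx => hx.1) ?_ ?_ 0 ⟨le_rfl, abs_nonneg t⟩ |t|
    ⟨abs_nonneg t, le_rfl⟩ (abs_nonneg t)
  · simpa [hp.zero] using this
  · intro x hx
    rw [interior_Icc] at hx
    exact (hp.diff x hx.1).differentiableWithinAt
  · intro x hx
    rw [interior_Icc] at hx
    exact (hδ' ⟨hx.1, hx.2.trans ht'⟩ : κ < deriv p x).le

/-- Midpoint form of the weak convexity of the even extension of the penalty. -/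
lemma two_mul_le (hp : IsWCCP p lam rho mu) (a b : ℝ) :
    2 * p |a| ≤ p |a + b| + p |a - b| + mu * b ^ 2 := by
  have hmu := hp.mu_pos
  have hmid : |a| ≤ (|a + b| + |a - b|) / 2 := by
    have := abs_add_le (a + b) (a - b)
    rw [show a + b + (a - b) = 2 * a by ring, abs_mul, abs_two] at this
    linarith
  have h1 := hp.monotoneOn (abs_nonneg a) (show (|a + b| + |a - b|) / 2 ∈ Set.Ici 0 by
    simp only [Set.mem_Ici]; positivity) hmid
  have h2 := hp.weakly_convex.2 (abs_nonneg (a + b)) (abs_nonneg (a - b))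
    (show (0 : ℝ) ≤ 1 / 2 by norm_num) (show (0 : ℝ) ≤ 1 / 2 by norm_num) (by norm_num)
  simp only [smul_eq_mul, sq_abs] at h2
  rw [show 1 / 2 * |a + b| + 1 / 2 * |a - b| = (|a + b| + |a - b|) / 2 by ring] at h2
  -- Convexity at the midpoint leaves the error `mu * (a ^ 2 + b ^ 2)` minus `mu` times the squared
  -- midpoint; this inequality reduces it to `mu * b ^ 2`.
  have h3 : a ^ 2 ≤ ((|a + b| + |a - b|) / 2) ^ 2 := by
    rw [← sq_abs a]; gcongr
  nlinarith

end IsWCCP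

end Penalty

/-! ### Vectors supported on a coordinate set -/

section Coordinates

variable {d : ℕ}

/-- The subspace of the vectors supported on `Γ`. -/
def coordSubspace (Γ : Finset (Fin d)) : Submodule ℝ (EuclideanSpace ℝ (Fin d)) where
  carrier := {x | ∀ j, j ∉ Γ → x j = 0}
  add_mem' hx hy j hj := by
    simp [hx j hj, hy j hj]
  zero_mem' j _ := rfl
  smul_mem' a x hx j hj := by
    simp [hx j hj]

lemma self_mem_coordSubspace_supp (β : EuclideanSpace ℝ (Fin d)) : β ∈ coordSubspace (supp β) := by
  intro j hj
  simpa [supp] using hj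

/-- The coordinates in `Γ` of a vector. -/
def restrict (Γ : Finset (Fin d)) (x : EuclideanSpace ℝ (Fin d)) : EuclideanSpace ℝ Γ :=
  WithLp.toLp 2 fun j => x j

/-- The vector which agrees with `x` on `Γ` and vanishes elsewhere. -/
def truncate (Γ : Finset (Fin d)) (x : EuclideanSpace ℝ (Fin d)) : EuclideanSpace ℝ (Fin d) :=
  WithLp.toLp 2 fun j => if j ∈ Γ then x j else 0

lemma sum_subtype_of_eq_zero {Γ : Finset (Fin d)} {f : Fin d → ℝ} (hf : ∀ j, j ∉ Γ → f j = 0) :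
    ∑ j : Γ, f j = ∑ j, f j := by
  rw [Finset.sum_coe_sort Γ f]
  exact Finset.sum_subset (Finset.subset_univ Γ) fun j _ hj => hf j hj

lemma norm_restrict {Γ : Finset (Fin d)} {x : EuclideanSpace ℝ (Fin d)}
    (hx : x ∈ coordSubspace Γ) : ‖restrict Γ x‖ = ‖x‖ := by
  rw [EuclideanSpace.norm_eq, EuclideanSpace.norm_eq]
  congr 1
  exact sum_subtype_of_eq_zero (f := fun j => ‖x j‖ ^ 2) fun j hj => by simp [hx j hj]

lemma bil_sub_restrict {Γ : Finset (Fin d)} (A : Matrix (Fin d) (Fin d) ℝ)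
    {x y : EuclideanSpace ℝ (Fin d)} (hx : x ∈ coordSubspace Γ) (hy : y ∈ coordSubspace Γ) :
    bil (sub A Γ Γ) (restrict Γ x) (restrict Γ y) = bil A x y := by
  rw [bil_eq_sum, bil_eq_sum]
  have h1 : ∀ j : Fin d, ∑ k : Γ, A j k * x j * y k = ∑ k, A j k * x j * y k := fun j =>
    sum_subtype_of_eq_zero (f := fun k => A j k * x j * y k) fun k hk => by simp [hy k hk]
  rw [← sum_subtype_of_eq_zero (Γ := Γ) (f := fun j => ∑ k, A j k * x j * y k)
    fun j hj => by simp [hx j hj]]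
  exact Finset.sum_congr rfl fun j _ => h1 j

lemma sum_abs_le {Γ : Finset (Fin d)} {x : EuclideanSpace ℝ (Fin d)} (hx : x ∈ coordSubspace Γ) :
    ∑ j ∈ Γ, |x j| ≤ √(Γ.card : ℝ) * ‖x‖ := by
  have h1 := sq_sum_le_card_mul_sum_sq (s := Γ) (f := fun j => |x j|)
  have h2 : ∑ j ∈ Γ, |x j| ^ 2 = ‖x‖ ^ 2 := by
    rw [EuclideanSpace.norm_sq_eq]
    exact Finset.sum_subset (Finset.subset_univ Γ) fun j _ hj => by simp [hx j hj]
  rw [h2] at h1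
  refine abs_le_of_sq_le_sq' ?_ (by positivity) |>.2
  rwa [mul_pow, Real.sq_sqrt (by positivity)]

end Coordinates

/-! ### Deterministic analysis on the good event -/

section Deterministic

variable {n d : ℕ} {Z : Fin n → Matrix (Fin d) (Fin d) ℝ} {Γ : Finset (Fin d)}
  {βs : EuclideanSpace ℝ (Fin d)} {c₃ c₄ c₅ lam rho mu N t : ℝ} {p : ℝ → ℝ} {e : Fin n → ℝ}

lemma RestrictedBounds.lower (hRB : RestrictedBounds Z Γ c₃ c₄) {x y : EuclideanSpace ℝ (Fin d)}
    (hx : x ∈ coordSubspace Γ) (hy : y ∈ coordSubspace Γ) :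
    c₃ * ‖x‖ ^ 2 * ‖y‖ ^ 2 ≤ 1 / (n : ℝ) * ∑ i, bil (Z i) x y ^ 2 := by
  simpa only [norm_restrict hx, norm_restrict hy, bil_sub_restrict _ hx hy] using
    (hRB (restrict Γ x) (restrict Γ y)).1

lemma RestrictedBounds.upper (hRB : RestrictedBounds Z Γ c₃ c₄) {x y : EuclideanSpace ℝ (Fin d)}
    (hx : x ∈ coordSubspace Γ) (hy : y ∈ coordSubspace Γ) :
    1 / (n : ℝ) * ∑ i, bil (Z i) x y ^ 2 ≤ c₄ * ‖x‖ ^ 2 * ‖y‖ ^ 2 := by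
  simpa only [norm_restrict hx, norm_restrict hy, bil_sub_restrict _ hx hy] using
    (hRB (restrict Γ x) (restrict Γ y)).2

/-- Error vectors whose bilinear noise on `Γ` and whose entrywise noise are bounded. -/
structure GoodErrors (Z : Fin n → Matrix (Fin d) (Fin d) ℝ) (Γ : Finset (Fin d)) (N t : ℝ)
    (e : Fin n → ℝ) : Prop where
  bilinear : ∀ x ∈ coordSubspace Γ, ∀ y ∈ coordSubspace Γ,
    |1 / (n : ℝ) * ∑ i, e i * bil (Z i) x y| ≤ N * ‖x‖ * ‖y‖
  entry : ∀ j k, |1 / (n : ℝ) * ∑ i, e i * Z i j k| ≤ t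

/-- Closedness gives measurability of the good event and is the input to the measurable selection of
minimisers. -/
lemma isClosed_setOf_goodErrors : IsClosed {e | GoodErrors Z Γ N t e} := by
  have : {e | GoodErrors Z Γ N t e} =
      (⋂ x ∈ coordSubspace Γ, ⋂ y ∈ coordSubspace Γ,
        {e | |1 / (n : ℝ) * ∑ i, e i * bil (Z i) x y| ≤ N * ‖x‖ * ‖y‖}) ∩
      ⋂ j, ⋂ k, {e | |1 / (n : ℝ) * ∑ i, e i * Z i j k| ≤ t} := by
    ext e
    simp only [Set.mem_inter_iff, Set.mem_iInter, Set.mem_ofPred_eq]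
    exact ⟨fun h => ⟨h.1, h.2⟩, fun h => ⟨h.1, h.2⟩⟩
  rw [this]
  refine IsClosed.inter ?_ ?_
  · refine isClosed_biInter fun x _ => isClosed_biInter fun y _ => ?_
    exact isClosed_le (by fun_prop) continuous_const
  · refine isClosed_iInter fun j => isClosed_iInter fun k => ?_
    exact isClosed_le (by fun_prop) continuous_const

/-- Difference of squares. The factor `x + y` is written through `x - y` so that, at `y = βs`, its
norm is governed by the error and `‖βs‖`. -/
lemma bil_self_sub_bil_self {A : Matrix (Fin d) (Fin d) ℝ} (hA : A.IsSymm)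
    (x y : EuclideanSpace ℝ (Fin d)) :
    bil A x x - bil A y y = bil A (x - y) (x - y + (2 : ℝ) • y) := by
  rw [bil_add_right, bil_smul_right, bil_sub_left, bil_sub_left, bil_sub_right, bil_sub_right,
    bil_comm hA y x]
  ring

lemma bil_sub_response (hZ : ∀ i, (Z i).IsSymm) (β : EuclideanSpace ℝ (Fin d)) (i : Fin n) :
    bil (Z i) β β - response Z βs e i = bil (Z i) (β - βs) (β - βs + (2 : ℝ) • βs) - e i := by
  rw [response, ← bil_self_sub_bil_self (hZ i)]
  ring

/-- Basic inequality: a competitor whose objective is at most that of `βs` is close to `βs`. -/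
lemma basic_inequality (hp : IsWCCP p lam rho mu) (hZ : ∀ i, (Z i).IsSymm)
    (hRB : RestrictedBounds Z Γ c₃ c₄) (he : GoodErrors Z Γ N t e) (hβs : βs ∈ coordSubspace Γ)
    {β : EuclideanSpace ℝ (Fin d)} (hβ : β ∈ coordSubspace Γ)
    (hle : objective Z (response Z βs e) p β ≤ objective Z (response Z βs e) p βs) :
    c₃ / 4 * ‖β - βs‖ ^ 2 * ‖β - βs + (2 : ℝ) • βs‖ ^ 2 ≤
      N / 2 * ‖β - βs‖ * ‖β - βs + (2 : ℝ) • βs‖ + lam * rho * (√(Γ.card : ℝ) * ‖β - βs‖) := by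
  have hh : β - βs ∈ coordSubspace Γ := sub_mem hβ hβs
  have hD : β - βs + (2 : ℝ) • βs ∈ coordSubspace Γ := add_mem hh (Submodule.smul_mem _ _ hβs)
  simp only [objective, bil_sub_response hZ] at hle
  have h0 : ∀ i, bil (Z i) (βs - βs) (βs - βs + (2 : ℝ) • βs) = 0 := fun i => by simp [bil]
  simp only [h0] at hle
  have hlow := hRB.lower hh hD
  have hnoise := (abs_le.1 (he.bilinear _ hh _ hD)).2
  set u := fun i => bil (Z i) (β - βs) (β - βs + (2 : ℝ) • βs) with hu
  have hexp : 1 / (4 * (n : ℝ)) * ∑ i, (u i - e i) ^ 2 = 1 / 4 * (1 / (n : ℝ) * ∑ i, u i ^ 2)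
      - 1 / 2 * (1 / (n : ℝ) * ∑ i, e i * u i) + 1 / (4 * (n : ℝ)) * ∑ i, (0 - e i) ^ 2 := by
    have : ∑ i, (u i - e i) ^ 2 = ∑ i, u i ^ 2 - 2 * ∑ i, e i * u i + ∑ i, (0 - e i) ^ 2 := by
      rw [Finset.mul_sum, ← Finset.sum_sub_distrib, ← Finset.sum_add_distrib]
      exact Finset.sum_congr rfl fun i _ => by ring
    rw [this, one_div, mul_inv]
    ring
  have hpen : ∑ j, p |βs j| - ∑ j, p |β j| ≤ lam * rho * (√(Γ.card : ℝ) * ‖β - βs‖) := by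
    have hs := hp.slope_pos
    calc ∑ j, p |βs j| - ∑ j, p |β j| = ∑ j, (p |βs j| - p |β j|) := by
          rw [Finset.sum_sub_distrib]
      _ = ∑ j ∈ Γ, (p |βs j| - p |β j|) :=
          (Finset.sum_subset (Finset.subset_univ Γ) fun j _ hj => by
            simp [hβ j hj, hβs j hj]).symm
      _ ≤ ∑ j ∈ Γ, lam * rho * |(β - βs) j| := Finset.sum_le_sum fun j _ => by
          rw [PiLp.sub_apply, abs_sub_comm]; exact hp.abs_sub_le _ _
      _ = lam * rho * ∑ j ∈ Γ, |(β - βs) j| := by rw [Finset.mul_sum]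
      _ ≤ _ := by gcongr; exact sum_abs_le hh
  rw [hexp] at hle
  linarith

lemma mul_sum_mul_le {u w : Fin n → ℝ} {a b : ℝ} (ha : 0 ≤ a) (hb : 0 ≤ b) (hc : 0 ≤ c₄)
    (hu : 1 / (n : ℝ) * ∑ i, u i ^ 2 ≤ c₄ * a ^ 2) (hw : 1 / (n : ℝ) * ∑ i, w i ^ 2 ≤ c₄ * b ^ 2) :
    |1 / (n : ℝ) * ∑ i, u i * w i| ≤ c₄ * (a * b) := by
  refine abs_le_of_sq_le_sq ?_ (by positivity)
  calc (1 / (n : ℝ) * ∑ i, u i * w i) ^ 2 = (1 / (n : ℝ)) ^ 2 * (∑ i, u i * w i) ^ 2 := by ring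
    _ ≤ (1 / (n : ℝ)) ^ 2 * ((∑ i, u i ^ 2) * ∑ i, w i ^ 2) := by
        gcongr; exact Finset.sum_mul_sq_le_sq_mul_sq _ _ _
    _ = (1 / (n : ℝ) * ∑ i, u i ^ 2) * (1 / (n : ℝ) * ∑ i, w i ^ 2) := by ring
    _ ≤ (c₄ * a ^ 2) * (c₄ * b ^ 2) := by
        gcongr
    _ = (c₄ * (a * b)) ^ 2 := by ring

/-- Quantitative midpoint convexity of the objective along directions supported on `Γ`. -/
lemma objective_midpoint (hp : IsWCCP p lam rho mu) (hZ : ∀ i, (Z i).IsSymm) (hc₄ : 0 ≤ c₄)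
    (hRB : RestrictedBounds Z Γ c₃ c₄) (he : GoodErrors Z Γ N t e) (hβs : βs ∈ coordSubspace Γ)
    {m δ : EuclideanSpace ℝ (Fin d)} (hm : m ∈ coordSubspace Γ) (hδ : δ ∈ coordSubspace Γ) :
    2 * objective Z (response Z βs e) p m +
        (2 * c₃ * ‖m‖ ^ 2 - c₄ * (‖m - βs‖ * ‖m - βs + (2 : ℝ) • βs‖) - N - mu) * ‖δ‖ ^ 2 ≤
      objective Z (response Z βs e) p (m + δ) + objective Z (response Z βs e) p (m - δ) := by
  have hh : m - βs ∈ coordSubspace Γ := sub_mem hm hβs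
  have hD : m - βs + (2 : ℝ) • βs ∈ coordSubspace Γ := add_mem hh (Submodule.smul_mem _ _ hβs)
  set y := response Z βs e with hy
  set u := fun i => bil (Z i) (m - βs) (m - βs + (2 : ℝ) • βs) with hu
  set w := fun i => bil (Z i) δ δ with hw
  set v := fun i => bil (Z i) δ m with hv
  have hQ : ∀ i, bil (Z i) m m - y i = u i - e i := fun i => bil_sub_response hZ m i
  have hplus : ∀ i, bil (Z i) (m + δ) (m + δ) - y i = u i - e i + w i + 2 * v i := fun i => by
    rw [← hQ, bil_add_left, bil_add_right, bil_add_right, bil_comm (hZ i) m δ]; ring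
  have hminus : ∀ i, bil (Z i) (m - δ) (m - δ) - y i = u i - e i + w i - 2 * v i := fun i => by
    rw [← hQ, bil_sub_left, bil_sub_right, bil_sub_right, bil_comm (hZ i) m δ]; ring
  have hv2 := hRB.lower hδ hm
  have huw : |1 / (n : ℝ) * ∑ i, u i * w i| ≤ c₄ * (‖m - βs‖ * ‖m - βs + (2 : ℝ) • βs‖ * ‖δ‖ ^ 2) :=
    mul_sum_mul_le (by positivity) (by positivity) hc₄
      ((hRB.upper hh hD).trans_eq (by ring)) ((hRB.upper hδ hδ).trans_eq (by ring))
  have hew := (abs_le.1 (he.bilinear _ hδ _ hδ)).2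
  have huw' := (abs_le.1 huw).1
  have hpen : 2 * ∑ j, p |m j| ≤ ∑ j, p |(m + δ) j| + ∑ j, p |(m - δ) j| + mu * ‖δ‖ ^ 2 := by
    rw [EuclideanSpace.norm_sq_eq, Finset.mul_sum, Finset.mul_sum, ← Finset.sum_add_distrib,
      ← Finset.sum_add_distrib]
    refine Finset.sum_le_sum fun j _ => ?_
    have := hp.two_mul_le (m j) (δ j)
    simpa using this
  -- The residuals at `m ± δ` are `u - e + w ± 2 * v`. Adding their squares cancels the terms linear
  -- in `v` and leaves `8 * v ^ 2`, the source of curvature; the nonnegative `2 * w ^ 2` is dropped.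
  have hloss : 2 * (1 / (4 * (n : ℝ)) * ∑ i, (u i - e i) ^ 2) + (1 / (n : ℝ) * ∑ i, u i * w i
      - 1 / (n : ℝ) * ∑ i, e i * w i + 2 * (1 / (n : ℝ) * ∑ i, v i ^ 2)) ≤
      1 / (4 * (n : ℝ)) * ∑ i, (u i - e i + w i + 2 * v i) ^ 2 +
      1 / (4 * (n : ℝ)) * ∑ i, (u i - e i + w i - 2 * v i) ^ 2 := by
    have key : 2 * ∑ i, (u i - e i) ^ 2 + (4 * ∑ i, u i * w i - 4 * ∑ i, e i * w i
        + 8 * ∑ i, v i ^ 2) ≤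
        ∑ i, (u i - e i + w i + 2 * v i) ^ 2 + ∑ i, (u i - e i + w i - 2 * v i) ^ 2 := by
      simp only [Finset.mul_sum, ← Finset.sum_add_distrib, ← Finset.sum_sub_distrib]
      exact Finset.sum_le_sum fun i _ => by nlinarith [sq_nonneg (w i)]
    have hn : 0 ≤ 1 / (4 * (n : ℝ)) := by positivity
    have := mul_le_mul_of_nonneg_left key hn
    have e4 : 1 / (n : ℝ) = 4 * (1 / (4 * (n : ℝ))) := by rw [one_div, one_div, mul_inv]; ring
    rw [e4]
    linarith
  simp only [objective, hQ, hplus, hminus]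
  linarith

/-- A vector supported on `Γ` at which the objective is locally minimal among such vectors, and at
which the gradient of the loss outside `Γ` is below the slope of the penalty at zero, is a local
minimiser. -/
lemma isLocalMin_of_strict_dual (hp : IsWCCP p lam rho mu) (hZ : ∀ i, (Z i).IsSymm)
    {y : Fin n → ℝ} {β : EuclideanSpace ℝ (Fin d)} (hβ : β ∈ coordSubspace Γ)
    (hloc : ∀ᶠ b in 𝓝 β, b ∈ coordSubspace Γ → objective Z y p β ≤ objective Z y p b)
    (hdual : ∀ j, j ∉ Γ →
      |1 / (n : ℝ) * ∑ i, (bil (Z i) β β - y i) * (Z i *ᵥ β.ofLp) j| < lam * rho) :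
    IsLocalMin (objective Z y p) β := by
  set a : EuclideanSpace ℝ (Fin d) → EuclideanSpace ℝ (Fin d) := truncate Γ with ha
  have hacont : Continuous a := by
    refine (PiLp.continuous_toLp 2 _).comp (continuous_pi fun j => ?_)
    by_cases hj : j ∈ Γ
    · simp only [hj, if_true]; fun_prop
    · simp only [hj, if_false]; fun_prop
  have ha_apply : ∀ b j, a b j = if j ∈ Γ then b j else 0 := fun b j => rfl
  have haβ : a β = β := by
    ext j
    rw [ha_apply]
    split_ifs with hj
    exacts [rfl, (hβ j hj).symm]
  have ha_mem : ∀ b, a b ∈ coordSubspace Γ := fun b j hj => by rw [ha_apply, if_neg hj]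
  -- Write `b = a b + c` with `c` supported off `Γ`. The tangent bound for the square gives a loss
  -- increase of at least `∑ j, c j * G j b`. The half-weighted term accounts for `bil (Z i) c c`
  -- exactly and vanishes at `β`, where `G` is the loss gradient.
  let G : Fin d → EuclideanSpace ℝ (Fin d) → ℝ := fun j b =>
    1 / (n : ℝ) * ∑ i, (bil (Z i) (a b) (a b) - y i) *
      ((Z i *ᵥ (a b).ofLp) j + 1 / 2 * (Z i *ᵥ (b - a b).ofLp) j)
  have hGcont : ∀ j, Continuous (G j) := fun j => by
    simp only [G, Matrix.mulVec, dotProduct]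
    fun_prop
  have hGβ : ∀ j, G j β = 1 / (n : ℝ) * ∑ i, (bil (Z i) β β - y i) * (Z i *ᵥ β.ofLp) j := fun j => by
    simp [G, haβ]
  have hsmall : ∀ᶠ b in 𝓝 β, ∀ j, j ∉ Γ → |G j b| * |b j| ≤ p |b j| := by
    refine eventually_all.2 fun j => ?_
    by_cases hj : j ∈ Γ
    · simp [hj]
    have hlt := hdual j hj
    rw [← hGβ] at hlt
    obtain ⟨κ, hκ1, hκ2⟩ := exists_between hlt
    have h1 : ∀ᶠ b in 𝓝 β, |G j b| < κ :=
      ((hGcont j).abs.tendsto β).eventually (gt_mem_nhds hκ1)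
    have hcoord : Tendsto (fun b : EuclideanSpace ℝ (Fin d) => b j) (𝓝 β) (𝓝 0) := by
      have : Continuous fun b : EuclideanSpace ℝ (Fin d) => b j := by fun_prop
      simpa [hβ j hj] using this.tendsto β
    filter_upwards [h1, hcoord.eventually (hp.eventually_mul_abs_le hκ2)] with b hb1 hb2 _
    exact (mul_le_mul_of_nonneg_right hb1.le (abs_nonneg _)).trans hb2
  have hloc' : ∀ᶠ b in 𝓝 β, objective Z y p β ≤ objective Z y p (a b) := by
    have ht : Tendsto a (𝓝 β) (𝓝 β) := by simpa [haβ] using hacont.tendsto β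
    filter_upwards [ht.eventually hloc] with b hb using hb (ha_mem b)
  filter_upwards [hsmall, hloc'] with b hb1 hb2
  refine hb2.trans ?_
  set c := b - a b with hc
  have hbc : b = a b + c := by rw [hc]; abel
  have hc_apply : ∀ j, c j = if j ∈ Γ then 0 else b j := fun j => by
    rw [hc, PiLp.sub_apply, ha_apply]
    split_ifs <;> simp
  have hlin : ∑ j, c j * G j b =
      1 / (n : ℝ) * ∑ i, (bil (Z i) (a b) (a b) - y i) *
        (bil (Z i) c (a b) + 1 / 2 * bil (Z i) c c) := by
    simp only [G, bil, dotProduct, Finset.mul_sum]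
    rw [Finset.sum_comm]
    refine Finset.sum_congr rfl fun i _ => ?_
    rw [← Finset.sum_add_distrib, Finset.mul_sum, Finset.mul_sum]
    exact Finset.sum_congr rfl fun j _ => by rw [← hc]; ring
  have hloss : 1 / (4 * (n : ℝ)) * ∑ i, (bil (Z i) (a b) (a b) - y i) ^ 2 + ∑ j, c j * G j b ≤
      1 / (4 * (n : ℝ)) * ∑ i, (bil (Z i) b b - y i) ^ 2 := by
    rw [hlin, show 1 / (n : ℝ) = 1 / (4 * (n : ℝ)) * 4 by rw [one_div, one_div, mul_inv]; ring,
      mul_assoc, ← mul_add, Finset.mul_sum, ← Finset.sum_add_distrib]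
    refine mul_le_mul_of_nonneg_left (Finset.sum_le_sum fun i _ => ?_) (by positivity)
    have : bil (Z i) b b = bil (Z i) (a b) (a b) + 2 * bil (Z i) c (a b) + bil (Z i) c c := by
      conv_lhs => rw [hbc]
      rw [bil_add_left, bil_add_right, bil_add_right, bil_comm (hZ i) (a b) c]; ring
    rw [this]
    nlinarith [sq_nonneg (2 * bil (Z i) c (a b) + bil (Z i) c c)]
  have hpen : ∑ j, p |a b j| ≤ ∑ j, p |b j| + ∑ j, c j * G j b := by
    rw [← Finset.sum_add_distrib]
    refine Finset.sum_le_sum fun j _ => ?_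
    rw [ha_apply, hc_apply]
    by_cases hj : j ∈ Γ
    · simp [hj]
    · simp only [hj, if_false, abs_zero, hp.zero]
      have h1 := hb1 j hj
      have h2 := neg_abs_le (b j * G j b)
      rw [abs_mul] at h2
      linarith
  simp only [objective]
  linarith

end Deterministic

/-! ### The gradient of the loss off the support -/

section DualBound

variable {n d : ℕ} {Z : Fin n → Matrix (Fin d) (Fin d) ℝ} {Γ : Finset (Fin d)}
  {βs : EuclideanSpace ℝ (Fin d)} {c₅ N t : ℝ} {e : Fin n → ℝ}

lemma abs_le_entrySup {m k : Type*} [Finite m] [Finite k] (A : Matrix m k ℝ) (i : m) (j : k) :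
    |A i j| ≤ entrySup A :=
  le_ciSup (f := fun q : m × k => |A q.1 q.2|) (Set.finite_range _).bddAbove (i, j)

lemma PartialOrthogonality.abs_sum_le (hPO : PartialOrthogonality Z Γ c₅) {k l m j : Fin d}
    (hk : k ∈ Γ) (hl : l ∈ Γ) (hm : m ∈ Γ) (hj : j ∉ Γ) :
    |∑ i, Z i k l * Z i j m| ≤ c₅ * √(n : ℝ) := by
  have h := (abs_le_entrySup (∑ i, sub (Z i) Γ Γ ⊗ₖ sub (Z i) Γᶜ Γ)
    (⟨k, hk⟩, ⟨j, by simpa using hj⟩) (⟨l, hl⟩, ⟨m, hm⟩)).trans hPO.2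
  simpa [Matrix.sum_apply, sub, Matrix.kroneckerMap_apply] using h

lemma mulVec_eq_sum_of_mem (A : Matrix (Fin d) (Fin d) ℝ) {x : EuclideanSpace ℝ (Fin d)}
    (hx : x ∈ coordSubspace Γ) (j : Fin d) : (A *ᵥ x.ofLp) j = ∑ m ∈ Γ, A j m * x m := by
  rw [Matrix.mulVec, dotProduct]
  exact (Finset.sum_subset (Finset.subset_univ Γ) fun m _ hm => by simp [hx m hm]).symm

lemma bil_eq_sum_of_mem (A : Matrix (Fin d) (Fin d) ℝ) {x y : EuclideanSpace ℝ (Fin d)}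
    (hx : x ∈ coordSubspace Γ) (hy : y ∈ coordSubspace Γ) :
    bil A x y = ∑ k ∈ Γ, ∑ l ∈ Γ, A k l * (x k * y l) := by
  rw [bil_eq_sum, ← Finset.sum_subset (Finset.subset_univ Γ) fun k _ hk => by simp [hx k hk]]
  refine Finset.sum_congr rfl fun k _ => ?_
  rw [← Finset.sum_subset (Finset.subset_univ Γ) fun l _ hl => by simp [hy l hl]]
  exact Finset.sum_congr rfl fun l _ => by ring

/-- The signal part of the gradient outside `Γ` is small by partial orthogonality. -/
lemma abs_sum_bil_mul_mulVec_le (hPO : PartialOrthogonality Z Γ c₅) (hc₅ : 0 ≤ c₅)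
    {x y z : EuclideanSpace ℝ (Fin d)} (hx : x ∈ coordSubspace Γ) (hy : y ∈ coordSubspace Γ)
    (hz : z ∈ coordSubspace Γ) {j : Fin d} (hj : j ∉ Γ) :
    |∑ i, bil (Z i) x y * (Z i *ᵥ z.ofLp) j| ≤
      c₅ * √(n : ℝ) * ((√(Γ.card : ℝ) * ‖x‖) * (√(Γ.card : ℝ) * ‖y‖) * (√(Γ.card : ℝ) * ‖z‖)) := by
  -- Each coefficient of this triple sum is one entry of the Kronecker sum; the three remaining ℓ¹
  -- norms cost a factor `√(Γ.card)` each.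
  have hexp : ∑ i, bil (Z i) x y * (Z i *ᵥ z.ofLp) j =
      ∑ k ∈ Γ, ∑ l ∈ Γ, ∑ m ∈ Γ, (∑ i, Z i k l * Z i j m) * (x k * y l * z m) := by
    simp only [bil_eq_sum_of_mem _ hx hy, mulVec_eq_sum_of_mem _ hz, Finset.sum_mul]
    rw [Finset.sum_comm]
    refine Finset.sum_congr rfl fun k _ => ?_
    rw [Finset.sum_comm]
    refine Finset.sum_congr rfl fun l _ => ?_
    simp only [Finset.mul_sum]
    rw [Finset.sum_comm]
    exact Finset.sum_congr rfl fun m _ => Finset.sum_congr rfl fun i _ => by ring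
  rw [hexp]
  calc _ ≤ ∑ k ∈ Γ, ∑ l ∈ Γ, ∑ m ∈ Γ, |(∑ i, Z i k l * Z i j m) * (x k * y l * z m)| :=
        (Finset.abs_sum_le_sum_abs _ _).trans <| Finset.sum_le_sum fun k _ =>
          (Finset.abs_sum_le_sum_abs _ _).trans <| Finset.sum_le_sum fun l _ =>
            Finset.abs_sum_le_sum_abs _ _
    _ ≤ ∑ k ∈ Γ, ∑ l ∈ Γ, ∑ m ∈ Γ, c₅ * √(n : ℝ) * (|x k| * |y l| * |z m|) := by
        refine Finset.sum_le_sum fun k hk => Finset.sum_le_sum fun l hl =>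
          Finset.sum_le_sum fun m hm => ?_
        rw [abs_mul, abs_mul, abs_mul]
        gcongr
        exact hPO.abs_sum_le hk hl hm hj
    _ = c₅ * √(n : ℝ) * ((∑ k ∈ Γ, |x k|) * (∑ l ∈ Γ, |y l|) * ∑ m ∈ Γ, |z m|) := by
        rw [Finset.sum_mul_sum, Finset.sum_mul, Finset.mul_sum]
        refine Finset.sum_congr rfl fun k _ => ?_
        rw [Finset.sum_mul, Finset.mul_sum]
        refine Finset.sum_congr rfl fun l _ => ?_
        rw [Finset.mul_sum, Finset.mul_sum]
    _ ≤ _ := by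
        gcongr
        exacts [sum_abs_le hx, sum_abs_le hy, sum_abs_le hz]

/-- The noise part of the gradient outside `Γ` is controlled by the entrywise noise. -/
lemma GoodErrors.abs_sum_mul_mulVec_le (he : GoodErrors Z Γ N t e) (ht : 0 ≤ t)
    {z : EuclideanSpace ℝ (Fin d)} (hz : z ∈ coordSubspace Γ) (j : Fin d) :
    |1 / (n : ℝ) * ∑ i, e i * (Z i *ᵥ z.ofLp) j| ≤ t * (√(Γ.card : ℝ) * ‖z‖) := by
  have hexp : 1 / (n : ℝ) * ∑ i, e i * (Z i *ᵥ z.ofLp) j =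
      ∑ m ∈ Γ, (1 / (n : ℝ) * ∑ i, e i * Z i j m) * z m := by
    simp only [mulVec_eq_sum_of_mem _ hz, Finset.mul_sum, Finset.sum_mul]
    rw [Finset.sum_comm]
    exact Finset.sum_congr rfl fun m _ => Finset.sum_congr rfl fun i _ => by ring
  rw [hexp]
  calc _ ≤ ∑ m ∈ Γ, |(1 / (n : ℝ) * ∑ i, e i * Z i j m) * z m| := Finset.abs_sum_le_sum_abs _ _
    _ ≤ ∑ m ∈ Γ, t * |z m| := by
        refine Finset.sum_le_sum fun m _ => ?_
        rw [abs_mul]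
        gcongr
        exact he.entry j m
    _ = t * ∑ m ∈ Γ, |z m| := by rw [Finset.mul_sum]
    _ ≤ _ := by gcongr; exact sum_abs_le hz

/-- The residual is signal minus error, and the parts are bounded separately. Averaging by `1 / n`
turns the `√n` of partial orthogonality into `1 / √n`. -/
lemma abs_gradient_le (hZ : ∀ i, (Z i).IsSymm) (hPO : PartialOrthogonality Z Γ c₅) (hc₅ : 0 ≤ c₅)
    (he : GoodErrors Z Γ N t e) (ht : 0 ≤ t) (hβs : βs ∈ coordSubspace Γ)
    {β : EuclideanSpace ℝ (Fin d)} (hβ : β ∈ coordSubspace Γ) {j : Fin d} (hj : j ∉ Γ) :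
    |1 / (n : ℝ) * ∑ i, (bil (Z i) β β - response Z βs e i) * (Z i *ᵥ β.ofLp) j| ≤
      c₅ / √(n : ℝ) * ((√(Γ.card : ℝ) * ‖β - βs‖) * (√(Γ.card : ℝ) * ‖β - βs + (2 : ℝ) • βs‖) *
        (√(Γ.card : ℝ) * ‖β‖)) + t * (√(Γ.card : ℝ) * ‖β‖) := by
  have hh : β - βs ∈ coordSubspace Γ := sub_mem hβ hβs
  have hD : β - βs + (2 : ℝ) • βs ∈ coordSubspace Γ := add_mem hh (Submodule.smul_mem _ _ hβs)
  have h1 := abs_sum_bil_mul_mulVec_le hPO hc₅ hh hD hβ hj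
  have h2 := he.abs_sum_mul_mulVec_le ht hβ j
  have h3 : 1 / (n : ℝ) * ∑ i, (bil (Z i) β β - response Z βs e i) * (Z i *ᵥ β.ofLp) j =
      1 / (n : ℝ) * ∑ i, bil (Z i) (β - βs) (β - βs + (2 : ℝ) • βs) * (Z i *ᵥ β.ofLp) j -
      1 / (n : ℝ) * ∑ i, e i * (Z i *ᵥ β.ofLp) j := by
    rw [← mul_sub, ← Finset.sum_sub_distrib]
    simp only [bil_sub_response hZ, sub_mul]
  rw [h3]
  refine (abs_sub _ _).trans (add_le_add ?_ h2)
  rw [abs_mul, abs_of_nonneg (show 0 ≤ 1 / (n : ℝ) by positivity)]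
  have h4 : 1 / (n : ℝ) * (c₅ * √(n : ℝ)) = c₅ / √(n : ℝ) := by
    rcases Nat.eq_zero_or_pos n with rfl | hn
    · simp
    have : (0 : ℝ) < n := by exact_mod_cast hn
    field_simp
    rw [Real.sq_sqrt this.le, mul_comm]
  refine (mul_le_mul_of_nonneg_left h1 (by positivity)).trans_eq ?_
  rw [← h4]
  ring

end DualBound

/-! ### Measurable selection of a unique minimiser -/

section Minimizer

/-- A unique minimiser over a compact set depends measurably on a parameter. -/
lemma exists_measurable_minimizer {X Y : Type*} [TopologicalSpace X] [MeasurableSpace X]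
    [BorelSpace X] [TopologicalSpace Y] [MeasurableSpace Y] [BorelSpace Y]
    {E : Set X} (hE : IsClosed E) {K : Set Y} (hK : IsCompact K) (hne : K.Nonempty)
    {f : X → Y → ℝ} (hf : Continuous fun q : X × Y => f q.1 q.2)
    (huniq : ∀ x ∈ E, ∀ y ∈ K, ∀ y' ∈ K, IsMinOn (f x) K y → IsMinOn (f x) K y' → y = y') (y₀ : Y) :
    ∃ g : X → Y, Measurable g ∧ (∀ x ∈ E, g x ∈ K ∧ IsMinOn (f x) K (g x)) ∧
      ∀ x, x ∉ E → g x = y₀ := by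
  classical
  have hex : ∀ x, ∃ y ∈ K, IsMinOn (f x) K y := fun x =>
    hK.exists_isMinOn hne (hf.comp (by fun_prop : Continuous fun y => (x, y))).continuousOn
  choose m hmK hm using hex
  refine ⟨fun x => if x ∈ E then m x else y₀, measurable_of_isClosed fun C hC => ?_,
    fun x hx => by simp [hx, hmK x, hm x], fun x hx => by simp [hx]⟩
  -- By uniqueness, a parameter in `E` is sent into `C` exactly when some minimiser lies in `C`,
  -- that is, when it lies in the projection of `G`. Projection along the compact `K ∩ C` preserves
  -- closedness.
  let G : Set (X × ↥(K ∩ C)) := {q | q.1 ∈ E ∧ ∀ z ∈ K, f q.1 q.2 ≤ f q.1 z}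
  have hG : IsClosed G := by
    have : G = (Prod.fst ⁻¹' E) ∩ ⋂ z ∈ K, {q : X × ↥(K ∩ C) | f q.1 q.2 ≤ f q.1 z} := by
      ext q
      simp [G]
    rw [this]
    refine (hE.preimage continuous_fst).inter (isClosed_biInter fun z _ => isClosed_le ?_ ?_)
    · exact hf.comp (continuous_fst.prodMk (continuous_subtype_val.comp continuous_snd))
    · exact hf.comp (continuous_fst.prodMk continuous_const)
  have : CompactSpace ↥(K ∩ C) := isCompact_iff_compactSpace.1 (hK.inter_right hC)
  have hproj : IsClosed (Prod.fst '' G) := isClosedMap_fst_of_compactSpace G hG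
  have hpre : (fun x => if x ∈ E then m x else y₀) ⁻¹' C =
      Prod.fst '' G ∪ (Eᶜ ∩ {_x | y₀ ∈ C}) := by
    ext x
    by_cases hx : x ∈ E
    · simp only [Set.mem_preimage, hx, if_true, Set.mem_union, Set.mem_image, Set.mem_inter_iff,
        Set.mem_compl_iff, not_true_eq_false, false_and, or_false]
      constructor
      · intro h
        exact ⟨(x, ⟨m x, hmK x, h⟩), ⟨hx, fun z hz => hm x hz⟩, rfl⟩
      · rintro ⟨⟨x', y, hyK, hyC⟩, ⟨_, hmin⟩, rfl⟩
        rw [huniq x' hx (m x') (hmK x') y hyK (hm x') fun z hz => hmin z hz]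
        exact hyC
    · have : x ∉ Prod.fst '' G := by
        rintro ⟨q, ⟨hq, _⟩, rfl⟩
        exact hx hq
      simp [hx, this]
  rw [hpre]
  exact hproj.measurableSet.union (hE.measurableSet.compl.inter (MeasurableSet.const _))

end Minimizer

/-! ### Probability of the good event -/

section Probability

variable {Ω : Type*} [MeasurableSpace Ω] {P : Measure Ω} {n d : ℕ} {ε : Fin n → Ω → ℝ} {σ : ℝ}
  {Z : Fin n → Matrix (Fin d) (Fin d) ℝ} {Γ : Finset (Fin d)} {c₃ c₄ : ℝ}

/-- The noise on `Γ` is the form of one symmetric matrix, so control on the net suffices; the factor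
`2` is the price of the net. -/
lemma goodErrors_of_net (hZ : ∀ i, (Z i).IsSymm) {T : Finset (EuclideanSpace ℝ Γ)}
    (hT₁ : ∀ y ∈ T, ‖y‖ ≤ 1)
    (hT : ∀ x : EuclideanSpace ℝ Γ, ‖x‖ ≤ 1 → ∃ y ∈ T, ‖x - y‖ ≤ 1 / 4) {t₁ t : ℝ} {e : Fin n → ℝ}
    (hquad : ∀ y ∈ T, |∑ i, 1 / (n : ℝ) * bil (sub (Z i) Γ Γ) y y * e i| ≤ t₁)
    (hentry : ∀ j k, |∑ i, 1 / (n : ℝ) * Z i j k * e i| ≤ t) :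
    GoodErrors Z Γ (2 * t₁) t e := by
  refine ⟨fun x hx y hy => ?_, fun j k => ?_⟩
  · have hA : (∑ i, (1 / (n : ℝ) * e i) • sub (Z i) Γ Γ).IsSymm := by
      rw [Matrix.IsSymm, Matrix.transpose_sum]
      refine Finset.sum_congr rfl fun i _ => ?_
      rw [Matrix.transpose_smul, sub, Matrix.transpose_submatrix, (hZ i).eq]
    have := abs_bil_le_of_net hA (T := T) (t := t₁)
      (fun x hx => let ⟨y, hy, hxy⟩ := hT x hx; ⟨y, hy, hT₁ y hy, hxy⟩) (fun y hy => ?_)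
      (restrict Γ x) (restrict Γ y)
    · rw [bil_sum_smul, norm_restrict hx, norm_restrict hy] at this
      simp only [bil_sub_restrict _ hx hy] at this
      convert this using 2
      rw [Finset.mul_sum]
      exact Finset.sum_congr rfl fun i _ => by ring
    · rw [bil_sum_smul]
      convert hquad y hy using 2
      exact Finset.sum_congr rfl fun i _ => by ring
  · convert hentry j k using 2
    rw [Finset.mul_sum]
    exact Finset.sum_congr rfl fun i _ => by ring

/-- Union bound for the failure of `GoodErrors`. -/
lemma IsNoise.measureReal_not_goodErrors_le [IsProbabilityMeasure P] (hε : IsNoise P ε σ)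
    (hZ : ∀ i, (Z i).IsSymm) (hZstd : ∑ i, entrySup (Z i) ^ 2 = n)
    (hRB : RestrictedBounds Z Γ c₃ c₄) (hc₄ : 0 ≤ c₄) {t₁ t : ℝ} (ht₁ : 0 < t₁) (ht : 0 < t) :
    P.real {ω | ¬ GoodErrors Z Γ (2 * t₁) t fun i => ε i ω} ≤
      2 * 9 ^ Γ.card * Real.exp (-t₁ ^ 2 / (2 * (σ ^ 2 * (c₄ / n)))) +
      2 * (d : ℝ) ^ 2 * Real.exp (-t ^ 2 / (2 * (σ ^ 2 * (1 / n)))) := by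
  obtain ⟨T, hcard, hT₁, hT⟩ := exists_net_unitBall (EuclideanSpace ℝ Γ)
  rw [finrank_euclideanSpace, Fintype.card_coe] at hcard
  let A : EuclideanSpace ℝ Γ → Set Ω := fun y =>
    {ω | t₁ < |∑ i, 1 / (n : ℝ) * bil (sub (Z i) Γ Γ) y y * ε i ω|}
  let B : Fin d × Fin d → Set Ω := fun q => {ω | t < |∑ i, 1 / (n : ℝ) * Z i q.1 q.2 * ε i ω|}
  have hsub : {ω | ¬ GoodErrors Z Γ (2 * t₁) t fun i => ε i ω} ⊆
      (⋃ y ∈ T, A y) ∪ ⋃ q ∈ (Finset.univ : Finset (Fin d × Fin d)), B q := by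
    intro ω hω
    by_contra hcon
    simp only [Set.mem_union, Set.mem_iUnion, not_or, not_exists, Finset.mem_univ, exists_prop,
      true_and, A, B, Set.mem_ofPred_eq, not_and, not_lt] at hcon
    exact hω (goodErrors_of_net hZ hT₁ hT hcon.1 fun j k => hcon.2 (j, k))
  have hA : ∀ y ∈ T, P.real (A y) ≤ 2 * Real.exp (-t₁ ^ 2 / (2 * (σ ^ 2 * (c₄ / n)))) := by
    intro y hy
    refine hε.measureReal_abs_sum_ge_le _ ?_ ht₁
    have h1 : ∑ i, (1 / (n : ℝ) * bil (sub (Z i) Γ Γ) y y) ^ 2 =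
        1 / (n : ℝ) * (1 / (n : ℝ) * ∑ i, bil (sub (Z i) Γ Γ) y y ^ 2) := by
      simp only [Finset.mul_sum]
      exact Finset.sum_congr rfl fun i _ => by ring
    have h2 : c₄ * ‖y‖ ^ 2 * ‖y‖ ^ 2 ≤ c₄ * 1 ^ 2 * 1 ^ 2 := by
      have := hT₁ y hy
      gcongr
    have h3 : (0 : ℝ) ≤ 1 / n := by positivity
    rw [h1]
    exact (mul_le_mul_of_nonneg_left ((hRB y y).2.trans h2) h3).trans_eq (by ring)
  have hB : ∀ q ∈ (Finset.univ : Finset (Fin d × Fin d)),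
      P.real (B q) ≤ 2 * Real.exp (-t ^ 2 / (2 * (σ ^ 2 * (1 / n)))) := by
    intro q _
    refine hε.measureReal_abs_sum_ge_le _ ?_ ht
    have h1 : ∑ i, (1 / (n : ℝ) * Z i q.1 q.2) ^ 2 = (1 / (n : ℝ)) ^ 2 * ∑ i, Z i q.1 q.2 ^ 2 := by
      simp only [Finset.mul_sum]
      exact Finset.sum_congr rfl fun i _ => by ring
    have h2 : ∑ i, Z i q.1 q.2 ^ 2 ≤ n := by
      rw [← hZstd]
      refine Finset.sum_le_sum fun i _ => ?_
      rw [← sq_abs (Z i q.1 q.2)]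
      gcongr
      exact abs_le_entrySup _ _ _
    rw [h1]
    refine (mul_le_mul_of_nonneg_left h2 (by positivity)).trans_eq ?_
    rcases Nat.eq_zero_or_pos n with rfl | hn
    · simp
    have : (n : ℝ) ≠ 0 := by exact_mod_cast hn.ne'
    field_simp
  calc _ ≤ P.real ((⋃ y ∈ T, A y) ∪ ⋃ q ∈ (Finset.univ : Finset (Fin d × Fin d)), B q) :=
        measureReal_mono hsub
    _ ≤ P.real (⋃ y ∈ T, A y) + P.real (⋃ q ∈ (Finset.univ : Finset (Fin d × Fin d)), B q) :=
        measureReal_union_le _ _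
    _ ≤ ∑ y ∈ T, P.real (A y) + ∑ q, P.real (B q) :=
        add_le_add (measureReal_biUnion_finset_le _ _) (measureReal_biUnion_finset_le _ _)
    _ ≤ ∑ y ∈ T, 2 * Real.exp (-t₁ ^ 2 / (2 * (σ ^ 2 * (c₄ / n)))) +
        ∑ q : Fin d × Fin d, 2 * Real.exp (-t ^ 2 / (2 * (σ ^ 2 * (1 / n)))) :=
        add_le_add (Finset.sum_le_sum hA) (Finset.sum_le_sum hB)
    _ ≤ _ := by
        rw [Finset.sum_const, Finset.sum_const, nsmul_eq_mul, nsmul_eq_mul, Finset.card_univ,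
          Fintype.card_prod, Fintype.card_fin]
        have : (T.card : ℝ) ≤ 9 ^ Γ.card := by exact_mod_cast hcard
        refine add_le_add ?_ (le_of_eq (by push_cast; ring))
        calc (T.card : ℝ) * (2 * Real.exp (-t₁ ^ 2 / (2 * (σ ^ 2 * (c₄ / n))))) ≤
            9 ^ Γ.card * (2 * Real.exp (-t₁ ^ 2 / (2 * (σ ^ 2 * (c₄ / n))))) := by gcongr
          _ = _ := by ring

end Probability

/-! ### Construction of the estimator -/

section Estimator

variable {n d : ℕ} {Z : Fin n → Matrix (Fin d) (Fin d) ℝ} {Γ : Finset (Fin d)}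
  {βs : EuclideanSpace ℝ (Fin d)} {c₁ c₂ c₃ c₄ c₅ lam rho mu N t r : ℝ} {p : ℝ → ℝ}

lemma continuous_objective_response (hp : IsWCCP p lam rho mu) :
    Continuous fun q : (Fin n → ℝ) × EuclideanSpace ℝ (Fin d) =>
      objective Z (response Z βs q.1) p q.2 := by
  have hpen : ∀ j : Fin d, Continuous fun q : (Fin n → ℝ) × EuclideanSpace ℝ (Fin d) =>
      p |q.2 j| := fun j =>
    hp.continuous_comp_abs.comp (by fun_prop : Continuous
      fun q : (Fin n → ℝ) × EuclideanSpace ℝ (Fin d) => q.2 j)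
  simp only [objective, response]
  exact (continuous_const.mul (continuous_finsetSum _ fun i _ => by fun_prop)).add
    (continuous_finsetSum _ fun j _ => hpen j)

/-- The loss gradient vanishes at `0`, so the strict dual criterion applies with empty support. This
is the fallback for bad errors. -/
lemma isLocalMin_zero (hp : IsWCCP p lam rho mu) (hZ : ∀ i, (Z i).IsSymm) (y : Fin n → ℝ) :
    IsLocalMin (objective Z y p) 0 := by
  refine isLocalMin_of_strict_dual (Γ := ∅) hp hZ (zero_mem _) (.of_forall fun b hb => ?_)
    fun j _ => ?_
  · have : b = 0 := by
      ext j
      exact hb j (by simp)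
    rw [this]
  · simpa using hp.slope_pos

lemma norm_add_two_smul_bounds (βs h : EuclideanSpace ℝ (Fin d)) :
    2 * ‖βs‖ - ‖h‖ ≤ ‖h + (2 : ℝ) • βs‖ ∧ ‖h + (2 : ℝ) • βs‖ ≤ ‖h‖ + 2 * ‖βs‖ := by
  have e : ‖(2 : ℝ) • βs‖ = 2 * ‖βs‖ := by simp [norm_smul]
  constructor
  · rw [← e]
    have := norm_sub_norm_le ((2 : ℝ) • βs) (-h)
    rwa [norm_neg, sub_neg_eq_add, add_comm _ h] at this
  · rw [← e]
    exact norm_add_le _ _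

/-- The minimiser over the ball of radius `r` about `βs` in the coordinate subspace, chosen
measurably, is a local minimiser of the objective whenever the errors are good. -/
lemma exists_measurable_localMin (hp : IsWCCP p lam rho mu) (hZ : ∀ i, (Z i).IsSymm)
    (hc₄ : 0 ≤ c₄) (hc₅ : 0 ≤ c₅) (ht : 0 ≤ t) (hr : 0 < r)
    (hRB : RestrictedBounds Z Γ c₃ c₄) (hPO : PartialOrthogonality Z Γ c₅)
    (hβs : βs ∈ coordSubspace Γ)
    (hrad : ∀ H D : ℝ, 0 ≤ H → H ≤ r → 2 * ‖βs‖ - H ≤ D →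
      c₃ / 4 * H ^ 2 * D ^ 2 ≤ N / 2 * H * D + lam * rho * (√(Γ.card : ℝ) * H) → H < r)
    (hcurv : ∀ H D M : ℝ, 0 ≤ H → H ≤ r → 0 ≤ D → D ≤ H + 2 * ‖βs‖ → ‖βs‖ - H ≤ M → 0 ≤ M →
      0 < 2 * c₃ * M ^ 2 - c₄ * (H * D) - N - mu)
    (hdual : ∀ H D M : ℝ, 0 ≤ H → H ≤ r → 0 ≤ D → D ≤ H + 2 * ‖βs‖ → 0 ≤ M → M ≤ H + ‖βs‖ →
      c₅ / √(n : ℝ) * ((√(Γ.card : ℝ) * H) * (√(Γ.card : ℝ) * D) * (√(Γ.card : ℝ) * M)) +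
        t * (√(Γ.card : ℝ) * M) < lam * rho) :
    ∃ g : (Fin n → ℝ) → EuclideanSpace ℝ (Fin d), Measurable g ∧
      (∀ e, IsLocalMin (objective Z (response Z βs e) p) (g e)) ∧
      ∀ e, GoodErrors Z Γ N t e → g e ∈ coordSubspace Γ ∧ ‖g e - βs‖ ≤ r := by
  set K : Set (EuclideanSpace ℝ (Fin d)) := Metric.closedBall βs r ∩ coordSubspace Γ with hK
  have hKc : IsCompact K :=
    (isCompact_closedBall βs r).inter_right (coordSubspace Γ).closed_of_finiteDimensional
  have hβsK : βs ∈ K := ⟨Metric.mem_closedBall_self hr.le, hβs⟩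
  have hKconv : Convex ℝ K := (convex_closedBall βs r).inter (coordSubspace Γ).convex
  have huniq : ∀ e ∈ {e | GoodErrors Z Γ N t e}, ∀ y ∈ K, ∀ y' ∈ K,
      IsMinOn (objective Z (response Z βs e) p) K y →
      IsMinOn (objective Z (response Z βs e) p) K y' → y = y' := by
    intro e he y hy y' hy' hmin hmin'
    -- Two minimisers are `m ± δ`, and neither value exceeds that at `m`; positive curvature at `m`
    -- then forces `δ = 0`.
    set m := midpoint ℝ y y' with hm
    have hmK : m ∈ K := hKconv.midpoint_mem hy hy'
    set δ := (2⁻¹ : ℝ) • (y' - y) with hδ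
    have hδΓ : δ ∈ coordSubspace Γ := Submodule.smul_mem _ _ (sub_mem hy'.2 hy.2)
    have e1 : m + δ = y' := by
      rw [hm, hδ, midpoint_eq_smul_add, invOf_eq_inv]
      module
    have e2 : m - δ = y := by
      rw [hm, hδ, midpoint_eq_smul_add, invOf_eq_inv]
      module
    have hmid := objective_midpoint hp hZ hc₄ hRB he hβs hmK.2 hδΓ
    rw [e1, e2] at hmid
    have hHr : ‖m - βs‖ ≤ r := by simpa [dist_eq_norm] using hmK.1
    have hM : ‖βs‖ - ‖m - βs‖ ≤ ‖m‖ := by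
      have := norm_sub_norm_le βs (βs - m)
      rwa [sub_sub_cancel, norm_sub_rev βs m] at this
    have hpos := hcurv ‖m - βs‖ ‖m - βs + (2 : ℝ) • βs‖ ‖m‖ (norm_nonneg _) hHr (norm_nonneg _)
      (norm_add_two_smul_bounds βs _).2 hM (norm_nonneg _)
    have h1 : objective Z (response Z βs e) p y ≤ objective Z (response Z βs e) p m := hmin hmK
    have h2 : objective Z (response Z βs e) p y' ≤ objective Z (response Z βs e) p m := hmin' hmK
    have hδ0 : ‖δ‖ ^ 2 ≤ 0 := by
      by_contra! hcon
      have := mul_pos hpos hcon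
      linarith
    have hδ1 : δ = 0 := by
      have : ‖δ‖ ^ 2 = 0 := le_antisymm hδ0 (sq_nonneg _)
      simpa using this
    rw [← e1, ← e2, hδ1, add_zero, sub_zero]
  obtain ⟨g, hg, hgE, hgE'⟩ := exists_measurable_minimizer
    (isClosed_setOf_goodErrors (Z := Z) (Γ := Γ) (N := N) (t := t)) hKc ⟨βs, hβsK⟩
    (continuous_objective_response (Z := Z) (βs := βs) hp) huniq 0
  refine ⟨g, hg, fun e => ?_, fun e he => ?_⟩
  · by_cases he : GoodErrors Z Γ N t e
    · obtain ⟨hgK, hmin⟩ := hgE e he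
      have hHr : ‖g e - βs‖ ≤ r := by simpa [dist_eq_norm] using hgK.1
      have hD := norm_add_two_smul_bounds βs (g e - βs)
      have hlt := hrad _ _ (norm_nonneg _) hHr hD.1
        (basic_inequality hp hZ hRB he hβs hgK.2 (hmin hβsK))
      refine isLocalMin_of_strict_dual hp hZ hgK.2 ?_ fun j hj => ?_
      -- Strict interiority turns minimality over `K` into local minimality within the subspace.
      · have hball : Metric.ball βs r ∈ 𝓝 (g e) :=
          Metric.isOpen_ball.mem_nhds (by simpa [dist_eq_norm] using hlt)
        filter_upwards [hball] with b hb hbΓ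
        exact hmin ⟨Metric.ball_subset_closedBall hb, hbΓ⟩
      · refine (abs_gradient_le hZ hPO hc₅ he ht hβs hgK.2 hj).trans_lt
          (hdual _ _ _ (norm_nonneg _) hHr (norm_nonneg _) hD.2 (norm_nonneg _) ?_)
        simpa using norm_add_le (g e - βs) βs
    · rw [hgE' e he]
      exact isLocalMin_zero hp hZ _
  · obtain ⟨hgK, -⟩ := hgE e he
    exact ⟨hgK.2, by simpa [dist_eq_norm] using hgK.1⟩

end Estimator

/-! ### Numerical inequalities -/

section Constants

/-- The localisation step: the basic inequality forces the error strictly below the radius. -/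
lemma lt_radius_of_basic_inequality {c₁ c₃ S a ρ C l r B H D : ℝ} (hc₁ : 0 < c₁)
    (hS : 0 < S) (ha : 0 ≤ a) (hρ : 0 ≤ ρ) (hl : 0 < l) (hC₁ : 10 * a ≤ C * (c₁ * c₃))
    (hC₂ : 4 ≤ C * (c₁ ^ 2 * c₃)) (hr : r = C * (ρ + l / S)) (hr0 : 0 < r)
    (hrS : r ≤ c₁ * S / 14)
    (hB : c₁ * S ≤ B) (hHr : H ≤ r) (hD : 2 * B - H ≤ D)
    (h : c₃ / 4 * H ^ 2 * D ^ 2 ≤ 8 * a * S * ρ / 2 * H * D + l * (S * H)) : H < r := by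
  by_contra! hcon
  obtain rfl : H = r := le_antisymm hHr hcon
  have hcS : 0 < c₁ * S := mul_pos hc₁ hS
  have hD0 : 27 / 14 * (c₁ * S) ≤ D := by linarith
  have hDpos : 0 < D := by linarith
  have h1 : c₃ / 4 * H * D ^ 2 ≤ 4 * a * S * ρ * D + l * S := by
    refine le_of_mul_le_mul_right ?_ hr0
    linarith
  have hlS : 0 < l / S := div_pos hl hS
  -- The two entries of the maximum defining `C₀` are used separately: the first pays for the noise,
  -- the second for the penalty.
  have h2 : (10 * a * ρ + 4 * (l / S) / c₁) / c₁ ≤ c₃ * H := by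
    rw [hr, div_le_iff₀ hc₁]
    have e1 : 4 * (l / S) / c₁ ≤ C * (c₁ * c₃) * (l / S) := by
      rw [div_le_iff₀ hc₁]
      have := mul_le_mul_of_nonneg_right hC₂ hlS.le
      linarith
    have e2 := mul_le_mul_of_nonneg_right hC₁ hρ
    linarith
  have h3 : (27 / 14 * (c₁ * S)) * D ≤ D ^ 2 := by nlinarith
  have h4 : (27 / 14 * (c₁ * S)) ^ 2 ≤ D ^ 2 := by gcongr
  have h5 : 10 * a * ρ / c₁ * D ^ 2 + 4 * (l / S) / c₁ ^ 2 * D ^ 2 ≤ 4 * (4 * a * S * ρ * D + l * S) := by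
    calc _ = (10 * a * ρ + 4 * (l / S) / c₁) / c₁ * D ^ 2 := by field_simp
      _ ≤ c₃ * H * D ^ 2 := by gcongr
      _ ≤ _ := by linarith
  have h6 : 10 * a * ρ / c₁ * ((27 / 14 * (c₁ * S)) * D) ≤ 10 * a * ρ / c₁ * D ^ 2 := by gcongr
  have h7 : 4 * (l / S) / c₁ ^ 2 * (27 / 14 * (c₁ * S)) ^ 2 ≤ 4 * (l / S) / c₁ ^ 2 * D ^ 2 := by gcongr
  -- Contradiction with `h5`: the noise coefficient `270 / 14` exceeds `16`, and the penalty
  -- coefficient `4 * (27 / 14) ^ 2` exceeds `4`.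
  have e6 : 10 * a * ρ / c₁ * ((27 / 14 * (c₁ * S)) * D) = 270 / 14 * (a * S * ρ * D) := by
    field_simp; ring
  have e7 : 4 * (l / S) / c₁ ^ 2 * (27 / 14 * (c₁ * S)) ^ 2 = 4 * (27 / 14) ^ 2 * (l * S) := by
    field_simp
  have h8 : 0 ≤ a * S * ρ * D := by positivity
  have h9 : 0 < l * S := by positivity
  linarith

/-- The main term is `2 * c₁ ^ 2 * c₃ * S ^ 2`. One half pays for `mu`; the other, through `hrn`
multiplied by `S`, pays for the noise, the cross term and the loss from replacing `B` by `M`. -/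
lemma curvature_pos {c₁ c₂ c₃ c₄ S a ρ r mu B H D M : ℝ} (hc₁ : 0 < c₁) (hc₂ : 0 < c₂)
    (hc₃ : 0 < c₃) (hc₄ : 0 < c₄) (hS : 0 < S) (ha : 0 ≤ a) (hρ : 0 ≤ ρ) (hr0 : 0 < r)
    (hrS : r ≤ c₂ * S / 14) (hrB : r ≤ B) (hB₁ : c₁ * S ≤ B) (hB₂ : B ≤ c₂ * S)
    (hmu : mu ≤ c₁ ^ 2 * c₃ * S ^ 2)
    (hrn : 2 * (4 * c₃ + 3 * c₄) * c₂ * r + 10 * a * ρ ≤ c₁ ^ 2 * c₃ * S)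
    (hHr : H ≤ r) (hD : 0 ≤ D) (hDB : D ≤ H + 2 * B) (hM : B - H ≤ M) :
    0 < 2 * c₃ * M ^ 2 - c₄ * (H * D) - 8 * a * S * ρ - mu := by
  have h1 : (c₁ * S) ^ 2 - 2 * r * (c₂ * S) ≤ M ^ 2 := by
    have e1 : (B - r) ^ 2 ≤ M ^ 2 := by
      have : 0 ≤ B - r := by linarith
      gcongr
      linarith
    have e2 : (c₁ * S) ^ 2 ≤ B ^ 2 := by gcongr
    have e3 : r * B ≤ r * (c₂ * S) := by gcongr
    linarith [sq_nonneg r]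
  have h2 : H * D ≤ r * (29 / 14 * (c₂ * S)) := by
    have : D ≤ 29 / 14 * (c₂ * S) := by linarith
    gcongr
  have h3 := mul_le_mul_of_nonneg_right hrn hS.le
  have h4 : c₄ * (H * D) ≤ c₄ * (r * (29 / 14 * (c₂ * S))) := by gcongr
  have h5 : 2 * c₃ * ((c₁ * S) ^ 2 - 2 * r * (c₂ * S)) ≤ 2 * c₃ * M ^ 2 := by gcongr
  have p1 : 0 ≤ c₃ * (c₂ * r * S) := by positivity
  have p2 : 0 ≤ c₄ * (c₂ * r * S) := by positivity
  have p3 : 0 ≤ a * ρ * S := by positivity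
  have p4 : 0 < c₁ ^ 2 * c₃ * S ^ 2 := by positivity
  linarith

/-- The signal uses at most `435 / 196 * (2 / 36)` of `l` and the noise at most `15 / 14 * (2 / 3)`,
together less than `1`. -/
lemma gradient_lt {c₂ c₅ S ρ C l r Q t B H D M : ℝ} (hc₂ : 0 < c₂) (hc₅ : 0 < c₅)
    (hS : 0 < S) (hC : 0 < C) (hl : 0 < l) (hρ : 0 ≤ ρ) (hQ : 0 < Q) (ht : 0 ≤ t)
    (hr : r = C * (ρ + l / S)) (hrS : r ≤ c₂ * S / 14) (hB : B ≤ c₂ * S)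
    (hns : 36 * c₂ ^ 2 * c₅ * C * (S ^ 2) ^ 2 ≤ Q) (hl₁ : S * ρ ≤ l)
    (hl₂ : 3 / 2 * c₂ * S ^ 2 * t ≤ l)
    (hHr : H ≤ r) (hH : 0 ≤ H) (hD : 0 ≤ D) (hDB : D ≤ H + 2 * B) (hM : 0 ≤ M) (hMB : M ≤ H + B) :
    c₅ / Q * ((S * H) * (S * D) * (S * M)) + t * (S * M) < l := by
  have hD' : D ≤ 29 / 14 * (c₂ * S) := by linarith
  have hM' : M ≤ 15 / 14 * (c₂ * S) := by linarith
  have hr0 : 0 ≤ r := hH.trans hHr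
  have h1 : c₅ / Q * ((S * H) * (S * D) * (S * M)) ≤
      c₅ / Q * ((S * r) * (S * (29 / 14 * (c₂ * S))) * (S * (15 / 14 * (c₂ * S)))) := by gcongr
  have e1 : c₅ / Q * ((S * r) * (S * (29 / 14 * (c₂ * S))) * (S * (15 / 14 * (c₂ * S)))) =
      435 / 196 * ((c₂ ^ 2 * c₅ * C * (S ^ 2) ^ 2) / Q * (S * ρ + l)) := by
    rw [hr]
    field_simp
    ring
  have h2 : (c₂ ^ 2 * c₅ * C * (S ^ 2) ^ 2) / Q ≤ 1 / 36 := by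
    rw [div_le_iff₀ hQ]
    linarith
  have h3 : (c₂ ^ 2 * c₅ * C * (S ^ 2) ^ 2) / Q * (S * ρ + l) ≤ 1 / 36 * (l + l) := by gcongr
  have h4 : t * (S * M) ≤ t * (S * (15 / 14 * (c₂ * S))) := by gcongr
  linarith

/-- The cardinalities cost only `9 ^ s ≤ exp (2 * s * L)` and `d ^ 2 = exp (2 * log d)`. Both terms
are then at most `2 * exp (-6 * s * L)`, hence at most `exp (-s * L)` each. -/
lemma failure_le {s d : ℕ} {L : ℝ} (hs : 1 ≤ s) (hd : 1 ≤ d) (hL : Real.log 3 ≤ L) :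
    2 * 9 ^ s * Real.exp (-(8 * (s * L))) +
      2 * (d : ℝ) ^ 2 * Real.exp (-(16 * (s * L + Real.log d))) ≤ 2 * Real.exp (-(s * L)) := by
  have hs' : (1 : ℝ) ≤ s := by exact_mod_cast hs
  have hd' : (1 : ℝ) ≤ d := by exact_mod_cast hd
  have hL' : 2 / 3 ≤ L := by
    have := Real.one_sub_inv_le_log_of_pos (show (0 : ℝ) < 3 by norm_num)
    norm_num at this
    linarith
  have hx : 2 / 3 ≤ s * L := by nlinarith
  have hlogd : 0 ≤ Real.log d := Real.log_nonneg hd'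
  have h9 : (9 : ℝ) ^ s ≤ Real.exp (2 * (s * L)) := by
    calc (9 : ℝ) ^ s = Real.exp (2 * Real.log 3) ^ s := by
          rw [mul_comm, Real.exp_mul, Real.exp_log (by norm_num)]
          norm_num
      _ = Real.exp (s * (2 * Real.log 3)) := (Real.exp_nat_mul _ _).symm
      _ ≤ _ := Real.exp_le_exp.2 (by nlinarith)
  have hdd : (d : ℝ) ^ 2 = Real.exp (2 * Real.log d) := by
    rw [mul_comm, Real.exp_mul, Real.exp_log (by linarith)]
    norm_num
  have hhalf : Real.exp (-(6 * (s * L))) ≤ 1 / 2 * Real.exp (-(s * L)) := by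
    have h1 : Real.exp (-(6 * (s * L))) = Real.exp (-(5 * (s * L))) * Real.exp (-(s * L)) := by
      rw [← Real.exp_add]; ring_nf
    have h2 : Real.exp (-(5 * (s * L))) ≤ 1 / 2 := by
      rw [Real.exp_neg, one_div]
      gcongr
      linarith [Real.add_one_le_exp (5 * (s * L))]
    rw [h1]
    gcongr
  have t1 : 9 ^ s * Real.exp (-(8 * (s * L))) ≤ Real.exp (-(6 * (s * L))) := by
    calc _ ≤ Real.exp (2 * (s * L)) * Real.exp (-(8 * (s * L))) := by gcongr
      _ = _ := by rw [← Real.exp_add]; ring_nf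
  have t2 : (d : ℝ) ^ 2 * Real.exp (-(16 * (s * L + Real.log d))) ≤ Real.exp (-(6 * (s * L))) := by
    rw [hdd, ← Real.exp_add]
    exact Real.exp_le_exp.2 (by linarith)
  linarith

lemma norm_bounds_of_supp {d : ℕ} {β : EuclideanSpace ℝ (Fin d)} {c₁ c₂ : ℝ} (hc₁ : 0 ≤ c₁)
    (hc₂ : 0 ≤ c₂) (h : ∀ j ∈ supp β, c₁ ≤ |β j| ∧ |β j| ≤ c₂) :
    c₁ * √((supp β).card : ℝ) ≤ ‖β‖ ∧ ‖β‖ ≤ c₂ * √((supp β).card : ℝ) := by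
  have hsum : ‖β‖ ^ 2 = ∑ j ∈ supp β, |β j| ^ 2 := by
    rw [EuclideanSpace.norm_sq_eq]
    exact (Finset.sum_subset (Finset.subset_univ _) fun j _ hj => by
      simp [self_mem_coordSubspace_supp β j hj]).symm
  have hS : √((supp β).card : ℝ) ^ 2 = (supp β).card := Real.sq_sqrt (by positivity)
  constructor
  · refine abs_le_of_sq_le_sq' ?_ (norm_nonneg _) |>.2
    rw [mul_pow, hS, hsum, mul_comm, ← nsmul_eq_mul]
    refine Finset.card_nsmul_le_sum _ _ _ fun j hj => ?_
    have := (h j hj).1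
    gcongr
  · refine abs_le_of_sq_le_sq' ?_ (by positivity) |>.2
    rw [mul_pow, hS, hsum, mul_comm, ← nsmul_eq_mul]
    refine Finset.sum_le_card_nsmul _ _ _ fun j hj => ?_
    have := (h j hj).2
    gcongr

end Constants

end QuadReg

/-! ### The main theorem -/

open QuadReg in
theorem theorem2 {Ω : Type*} [MeasurableSpace Ω] (P : Measure Ω) [IsProbabilityMeasure P]
    (n d s : ℕ)
    (Z : Fin n → Matrix (Fin d) (Fin d) ℝ) (hZsymm : ∀ i, (Z i).IsSymm)
    (hZstd : ∑ i, QuadReg.entrySup (Z i) ^ 2 = n)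
    (βs : EuclideanSpace ℝ (Fin d)) (hs : s = (QuadReg.supp βs).card)
    (c₁ c₂ c₃ c₄ c₅ σ lam rho mu : ℝ)
    (hc₁ : 0 < c₁) (hc₁₂ : c₁ ≤ c₂)
    (hβs : ∀ j ∈ QuadReg.supp βs, c₁ ≤ |βs j| ∧ |βs j| ≤ c₂)
    (p : ℝ → ℝ) (hp : QuadReg.IsWCCP p lam rho mu)
    (ε : Fin n → Ω → ℝ) (hε : QuadReg.IsNoise P ε σ)
    (hc₃ : 0 < c₃) (hc₃₄ : c₃ ≤ c₄)
    (hRB : QuadReg.RestrictedBounds Z (QuadReg.supp βs) c₃ c₄)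
    (hc₅ : 0 < c₅) (hPO : QuadReg.PartialOrthogonality Z (QuadReg.supp βs) c₅)
    (C r : ℝ) (hC : C = QuadReg.C₀ σ c₁ c₃ c₄) (hr : r = QuadReg.radius n s C lam rho)
    (hns₁ : 36 * c₂ ^ 2 * c₅ * C * (s : ℝ) ^ 2 ≤ √(n : ℝ))
    (hns₂ : √(2 * Real.log (1 + 2 * n) / n) ≤ c₂ * C⁻¹)
    (hns₃ : 3 / √((n : ℝ) * s) ≤ c₂)
    (hlam₁ : max (√(s * Real.log (1 + 2 * n) / n))
        (6 * √2 * c₂ * σ * s * √((s * Real.log (1 + 2 * n) + Real.log d) / n)) ≤ lam * rho)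
    (hlam₂ : lam * rho ≤ c₂ * √(s : ℝ) / (√2 * C))
    (hmu : mu ≤ c₁ ^ 2 * c₃ * s)
    (hrn : 2 * (4 * c₃ + 3 * c₄) * c₂ * r + 10 * σ * √c₄ * √(Real.log (1 + 2 * n) / n)
        ≤ c₁ ^ 2 * c₃ * √(s : ℝ)) :
    ∃ βhat : Ω → EuclideanSpace ℝ (Fin d),
      Measurable βhat ∧
      (∀ ω, IsLocalMin
        (QuadReg.objective Z (QuadReg.response Z βs (fun i => ε i ω)) p) (βhat ω)) ∧
      P.real {ω | ∀ j, j ∉ QuadReg.supp βs → βhat ω j = 0}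
        ≥ 1 - QuadReg.prob₁ n s - 2 * QuadReg.prob₂ n - 2 / n ∧
      P.real {ω | min ‖βhat ω + βs‖ ‖βhat ω - βs‖ ≤ r}
        ≥ 1 - QuadReg.prob₁ n s - 2 * QuadReg.prob₂ n - 2 / n := by
  have hc₂ : 0 < c₂ := hc₁.trans_le hc₁₂
  have hc₄ : 0 < c₄ := hc₃.trans_le hc₃₄
  have hσ := hε.sigma_pos
  have hl : 0 < lam * rho := hp.slope_pos
  have hC₀ : 0 < C := by
    rw [hC, C₀]
    exact lt_max_of_lt_right (by positivity)
  have hC₁ : 10 * (σ * √c₄) ≤ C * (c₁ * c₃) := by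
    have : 10 * σ * √c₄ / (c₁ * c₃) ≤ C := hC ▸ le_max_left _ _
    rw [div_le_iff₀ (by positivity)] at this
    linarith
  have hC₂ : 4 ≤ C * (c₁ ^ 2 * c₃) := by
    have : 4 / (c₁ ^ 2 * c₃) ≤ C := hC ▸ le_max_right _ _
    rwa [div_le_iff₀ (by positivity)] at this
  set Γ := supp βs with hΓ
  set S := √(s : ℝ) with hS
  -- An empty support would make the upper bound on `lam * rho` zero.
  have hs1 : 1 ≤ s := by
    rcases Nat.eq_zero_or_pos s with h0 | h0
    · have hS0 : S = 0 := by rw [hS, h0]; simp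
      rw [hS0, mul_zero, zero_div] at hlam₂
      linarith
    · exact h0
  have hs0 : (0 : ℝ) < s := by exact_mod_cast hs1
  have hS0 : 0 < S := Real.sqrt_pos.2 hs0
  have hS2 : S ^ 2 = s := Real.sq_sqrt hs0.le
  have hd1 : 1 ≤ d := by
    have : Γ.card ≤ d := (Finset.card_le_univ Γ).trans_eq (Fintype.card_fin d)
    omega
  obtain ⟨hB₁, hB₂⟩ := norm_bounds_of_supp hc₁.le hc₂.le hβs
  rw [← hΓ, ← hs, ← hS] at hB₁ hB₂
  have hβsΓ : βs ∈ coordSubspace Γ := self_mem_coordSubspace_supp βs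
  have hB0 : 0 < ‖βs‖ := (mul_pos hc₁ hS0).trans_le hB₁
  have hn1 : 1 ≤ n := by
    rcases Nat.eq_zero_or_pos n with rfl | h0
    · have := hRB.lower hβsΓ hβsΓ
      have hpos : 0 < c₃ * ‖βs‖ ^ 2 * ‖βs‖ ^ 2 := by positivity
      simp at this
      linarith
    · exact h0
  have hn0 : (0 : ℝ) < n := by exact_mod_cast hn1
  set L := Real.log (1 + 2 * n) with hL
  have hL3 : Real.log 3 ≤ L := by
    have : (1 : ℝ) ≤ n := by exact_mod_cast hn1
    exact Real.log_le_log (by norm_num) (by linarith)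
  have hL0 : 0 < L := (Real.log_pos (by norm_num)).trans_le hL3
  set ρ := √(L / n) with hρ
  have hρ0 : 0 < ρ := Real.sqrt_pos.2 (by positivity)
  have hρ2 : ρ ^ 2 = L / n := Real.sq_sqrt (by positivity)
  have hrdef : r = C * (ρ + lam * rho / S) := hr
  have hr0 : 0 < r := by rw [hrdef]; positivity
  have ha0 : 0 < σ * √c₄ := by positivity
  -- The `14` is `2 * (4 + 3)` in `hrn`, after replacing `c₄` by `c₃`.
  have hr₁ : r ≤ c₁ * S / 14 := by
    have h1 : 14 * c₃ * c₂ * r ≤ c₁ * c₂ * c₃ * S := by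
      have e1 : c₃ * (c₂ * r) ≤ c₄ * (c₂ * r) := by gcongr
      have e2 : c₁ ^ 2 * c₃ * S ≤ c₁ * c₂ * c₃ * S := by
        rw [pow_two]
        gcongr
      have e3 : 0 ≤ 10 * σ * √c₄ * ρ := by positivity
      linarith
    have h2 : (c₃ * c₂) * (14 * r) ≤ (c₃ * c₂) * (c₁ * S) := by linarith
    have := le_of_mul_le_mul_left h2 (by positivity)
    linarith
  have hr₂ : r ≤ c₂ * S / 14 := by
    have : c₁ * S ≤ c₂ * S := by gcongr
    linarith
  have hlogd : 0 ≤ Real.log d := Real.log_nonneg (by exact_mod_cast hd1)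
  -- Chosen so that `3 / 2 * c₂ * s * t` is exactly the second lower bound on `lam * rho`; the
  -- entrywise tail exponent is then `16 * (s * L + log d)`.
  set t := 4 * √2 * σ * √((s * L + Real.log d) / n) with ht
  have ht0 : 0 < t := by
    have : 0 < √((s * L + Real.log d) / n) := Real.sqrt_pos.2 (by positivity)
    positivity
  have ht₁0 : 0 < 4 * (σ * √c₄) * S * ρ := by positivity
  have hSρ : √(s * L / n) = S * ρ := by
    rw [hS, hρ, mul_div_assoc, Real.sqrt_mul hs0.le]
  have hl₁ : S * ρ ≤ lam * rho := hSρ ▸ (le_max_left _ _).trans hlam₁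
  have hl₂ : 3 / 2 * c₂ * S ^ 2 * t ≤ lam * rho := by
    refine le_trans (le_of_eq ?_) ((le_max_right _ _).trans hlam₁)
    rw [hS2, ht]
    ring
  have hN : 2 * (4 * (σ * √c₄) * S * ρ) = 8 * (σ * √c₄) * S * ρ := by ring
  -- The net threshold `4 * (σ * √c₄) * S * ρ` gives the tail exponent `8 * s * L`, enough to beat
  -- `9 ^ s`.
  obtain ⟨g, hg, hgmin, hgood⟩ := exists_measurable_localMin (N := 2 * (4 * (σ * √c₄) * S * ρ))
    hp hZsymm hc₄.le hc₅.le ht0.le hr0 hRB hPO hβsΓ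
    (fun H D _ hHr hD h => by
      rw [← hs, hN] at h
      exact lt_radius_of_basic_inequality hc₁ hS0 ha0.le hρ0.le hl hC₁ hC₂ hrdef hr0 hr₁ hB₁
        hHr hD h)
    (fun H D M _ hHr hD hDB hM _ => by
      rw [hN]
      refine curvature_pos hc₁ hc₂ hc₃ hc₄ hS0 ha0.le hρ0.le hr0 hr₂ ?_ hB₁ hB₂ ?_ ?_ hHr hD
        hDB hM
      · have := mul_pos hc₁ hS0
        linarith
      · rwa [hS2]
      · linarith)
    (fun H D M hH hHr hD hDB hM hMB => by
      rw [← hs]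
      refine gradient_lt hc₂ hc₅ hS0 hC₀ hl hρ0.le (Real.sqrt_pos.2 hn0) ht0.le hrdef hr₂ hB₂ ?_
        hl₁ hl₂ hHr hH hD hDB hM hMB
      rwa [hS2])
  have hmeasε : Measurable fun ω => fun i => ε i ω := measurable_pi_lambda _ hε.meas
  set E : Set Ω := {ω | GoodErrors Z Γ (2 * (4 * (σ * √c₄) * S * ρ)) t fun i => ε i ω} with hE
  have hEm : MeasurableSet E := hmeasε isClosed_setOf_goodErrors.measurableSet
  have hfail : P.real Eᶜ ≤ prob₁ n s := by
    refine (hε.measureReal_not_goodErrors_le hZsymm hZstd hRB hc₄.le ht₁0 ht0).trans ?_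
    rw [← hs]
    have e1 : -(4 * (σ * √c₄) * S * ρ) ^ 2 / (2 * (σ ^ 2 * (c₄ / n))) = -(8 * (s * L)) := by
      rw [show (4 * (σ * √c₄) * S * ρ) ^ 2 = 16 * σ ^ 2 * √c₄ ^ 2 * S ^ 2 * ρ ^ 2 by ring,
        Real.sq_sqrt hc₄.le, hS2, hρ2]
      field_simp
      norm_num
    have e2 : -t ^ 2 / (2 * (σ ^ 2 * (1 / n))) = -(16 * (s * L + Real.log d)) := by
      rw [ht, show (4 * √2 * σ * √((s * L + Real.log d) / n)) ^ 2 =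
        16 * √2 ^ 2 * σ ^ 2 * √((s * L + Real.log d) / n) ^ 2 by ring,
        Real.sq_sqrt (by norm_num), Real.sq_sqrt (by positivity)]
      field_simp
    rw [e1, e2]
    exact failure_le hs1 hd1 hL3
  -- `prob₁` alone covers the failure; the other two terms are nonnegative slack.
  have hprob : 1 - prob₁ n s - 2 * prob₂ n - 2 / n ≤ P.real E := by
    have h1 : P.real E = 1 - P.real Eᶜ := by
      rw [probReal_compl_eq_one_sub hEm]
      ring
    have h2 : 0 ≤ prob₂ n := Real.rpow_nonneg hn0.le _
    have h3 : (0 : ℝ) ≤ 2 / n := by positivity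
    linarith
  refine ⟨fun ω => g fun i => ε i ω, hg.comp hmeasε, fun ω => hgmin _, ?_, ?_⟩
  · exact hprob.trans (measureReal_mono fun ω hω => (hgood _ hω).1)
  · exact hprob.trans (measureReal_mono fun ω hω => (min_le_right _ _).trans (hgood _ hω).2)
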